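/- Let $\mathbb{K}\in\{\mathbb{R},\mathbb{C}\}$, $a<b$ and $n\in\mathbb{N}$. Consider the hyperbolic boundary control system (hBCS) $$\frac{\partial x}{\partial t}(\xi,t)=P_1\frac{\partial}{\partial\xi}\bigl(\mathcal{H}(\xi)x(\xi,t)\bigr)+P_0(\xi)\mathcal{H}(\xi)x(\xi,t),\qquad u(t)=\widetilde W_B\begin{bmatrix}(\mathcal{H}x)(b,t)\\(\mathcal{H}x)(a,t)\end{bmatrix},\qquad y(t)=\widetilde W_C\begin{bmatrix}(\mathcal{H}x)(b,t)\\(\mathcal{H}x)(a,t)\end{bmatrix}$$ for $\xi\in[a,b]$, $t\ge 0$, and assume the following. 1. $P_1\in\mathbb{K}^{n\times n}$ is invertible and self-adjoint; $P_0\in L^\infty([a,b],\mathbb{K}^{n\times n})$; $\mathcal{H}\in L^\infty([a,b],\mathbb{K}^{n\times n})$, $\mathcal{H}(\xi)$ is self-adjoint for almost all $\xi$, and there are $M,m>0$ with $mI\le\mathcal{H}(\xi)\le MI$ for almost all $\xi\in[a,b]$; $\widetilde W_B,\widetilde W_C\in\mathbb{K}^{n\times 2n}$, and both $\widetilde W_B$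 and $\begin{bmatrix}\widetilde W_B\\ \widetilde W_C\end{bmatrix}\in\mathbb{K}^{2n\times 2n}$ have full rank; the operator $A=P_1\frac{\partial}{\partial\xi}\mathcal{H}+P_0\mathcal{H}$ with domain $$\mathrm{D}(A)=\Bigl\{x_0\in L^2([a,b],\mathbb{K}^n)\;\Big|\;\mathcal{H}x_0\in H^1([a,b],\mathbb{K}^n),\ \widetilde W_B\begin{bmatrix}(\mathcal{H}x_0)(b)\\(\mathcal{H}x_0)(a)\end{bmatrix}=0\Bigr\}$$ generates a $C_0$-semigroup on $L^2([a,b],\mathbb{K}^n)$. 2. There are $S,\mathcal{H}^D\in C^1([a,b],\mathbb{K}^{n\times n})$, with $S$ pointwise invertible and $\mathcal{H}^D$ pointwise diagonal and positive definite, and some $0\le k\le n$ such that $P_1\mathcal{H}=S^{-1}\begin{pmatrix}I_k&0\\0&-I_{n-k}\end{pmatrix}\mathcal{H}^D S$ almost everywhere on $[a,b]$. A classical solution on the state space $L^1([a,b],\mathbb{K}^n)$ is a triple $(u,x,y)$ with $u,y\in C([0,\infty),\mathbb{K}^n)$ and $x\in C^1([0,\infty),L^1([a,b],\mathbb{K}^n))$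 such that, for every $t\ge 0$, $\mathcal{H}x(t)\in W^{1,1}([a,b],\mathbb{K}^n)$ and the three equations above hold (the first one in $L^1$). Then the system is $L^1$-well-posed on the state space $L^1([a,b],\mathbb{K}^n)$, that is: for every $t>0$ there is a constant $c>0$ such that every classical solution $(u,x,y)$ on $L^1([a,b],\mathbb{K}^n)$ satisfies $$\|y\|_{L^1([0,t],\mathbb{K}^n)}+\|x(t)\|_{L^1([a,b],\mathbb{K}^n)}\le c\bigl(\|u\|_{L^1([0,t],\mathbb{K}^n)}+\|x(0)\|_{L^1([a,b],\mathbb{K}^n)}\bigr).$$ -/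

import Mathlib

open MeasureTheory Filter Topology Set
open scoped ComplexOrder

noncomputable section

/-- A strongly continuous one-parameter semigroup `(T t)_{t ≥ 0}` of bounded operators
(only the values at `t ≥ 0` matter). -/
structure IsC0Semigroup {𝕜 X : Type*} [RCLike 𝕜] [NormedAddCommGroup X] [NormedSpace 𝕜 X]
    (T : ℝ → X →L[𝕜] X) : Prop where
  map_zero : T 0 = ContinuousLinearMap.id 𝕜 X
  map_add : ∀ s t : ℝ, 0 ≤ s → 0 ≤ t → T (s + t) = (T s).comp (T t)
  strongly_continuous : ∀ x : X, Tendsto (fun t : ℝ => T t x) (𝓝[>] 0) (𝓝 x)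

/-- The (possibly unbounded) operator with graph `{(x, z) | A x z}` is the infinitesimal generator
of some strongly continuous semigroup on `X`: the pair `(x, z)` lies in the graph
(i.e. `x ∈ D(A)` and `A x = z`) if and only if `(T h x - x) / h → z` as `h → 0+`. -/
def GeneratesC0Semigroup (𝕜 : Type*) {X : Type*} [RCLike 𝕜] [NormedAddCommGroup X]
    [NormedSpace 𝕜 X] (A : X → X → Prop) : Prop :=
  ∃ T : ℝ → X →L[𝕜] X, IsC0Semigroup T ∧
    ∀ x z : X, A x z ↔
      Tendsto (fun h : ℝ => ((h : 𝕜)⁻¹) • (T h x - x)) (𝓝[>] 0) (𝓝 z)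

/-- `𝕂ⁿ` with its Euclidean norm. -/
abbrev KVec (𝕜 : Type*) [RCLike 𝕜] (n : ℕ) : Type _ := EuclideanSpace 𝕜 (Fin n)

/-- Matrix-vector product on `𝕂ⁿ` with its Euclidean norm. -/
def matAct {𝕜 : Type*} [RCLike 𝕜] {n : ℕ} (M : Matrix (Fin n) (Fin n) 𝕜) (w : KVec 𝕜 n) :
    KVec 𝕜 n :=
  WithLp.toLp 2 (M.mulVec w.ofLp)

/-- The product `W [w₁; w₂]` of an `n × 2n` matrix with a stacked vector. -/
def bdryAct {𝕜 : Type*} [RCLike 𝕜] {n : ℕ} (W : Matrix (Fin n) (Fin n ⊕ Fin n) 𝕜)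
    (w₁ w₂ : KVec 𝕜 n) : KVec 𝕜 n :=
  WithLp.toLp 2 (W.mulVec (Sum.elim w₁.ofLp w₂.ofLp))

/-- `v` is an absolutely continuous function on `[a,b]` whose derivative is (almost everywhere)
`g ∈ L^p([a,b])`; that is, `v` is the continuous representative of an element of `W^{1,p}` on
`[a,b]` and `g` is its weak derivative (`W^{1,2} = H¹`). -/
def HasSobolevDeriv {E : Type*} [NormedAddCommGroup E] [NormedSpace ℝ E] (p : ENNReal) (a b : ℝ)
    (v g : ℝ → E) : Prop :=
  MemLp g p (volume.restrict (Icc a b)) ∧ ∀ ξ ∈ Icc a b, v ξ = v a + ∫ s in a..ξ, g s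

/-- The data of a linear hyperbolic boundary control system on `[a,b]` with `n` components. -/
structure HBCS (𝕜 : Type*) [RCLike 𝕜] (n : ℕ) where
  a : ℝ
  b : ℝ
  hab : a < b
  /-- the matrix in front of the spatial derivative -/
  P₁ : Matrix (Fin n) (Fin n) 𝕜
  /-- the zero order coefficient -/
  P₀ : ℝ → Matrix (Fin n) (Fin n) 𝕜
  /-- the Hamiltonian -/
  H : ℝ → Matrix (Fin n) (Fin n) 𝕜
  /-- the boundary input matrix -/
  WB : Matrix (Fin n) (Fin n ⊕ Fin n) 𝕜
  /-- the boundary output matrix -/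
  WC : Matrix (Fin n) (Fin n ⊕ Fin n) 𝕜

namespace HBCS

variable {𝕜 : Type*} [RCLike 𝕜] {n : ℕ}

/-- Lebesgue measure on `[a,b]`. -/
def measure (Sys : HBCS 𝕜 n) : Measure ℝ := volume.restrict (Icc Sys.a Sys.b)

/-- The space `L^p([a,b], 𝕂ⁿ)`. -/
abbrev StateSpace (Sys : HBCS 𝕜 n) (p : ENNReal) : Type _ := Lp (KVec 𝕜 n) p Sys.measure

/-- `H x ∈ W^{1,p}([a,b], 𝕂ⁿ)` with continuous representative `v`, and
`z = P₁ ∂/∂ξ (H x) + P₀ (H x)`. -/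
def MaxOperator (Sys : HBCS 𝕜 n) (p : ENNReal) (x z : Sys.StateSpace p) (v : ℝ → KVec 𝕜 n) :
    Prop :=
  ∃ g : ℝ → KVec 𝕜 n, HasSobolevDeriv p Sys.a Sys.b v g ∧
    (∀ᵐ ξ ∂Sys.measure, v ξ = matAct (Sys.H ξ) (x ξ)) ∧
    (∀ᵐ ξ ∂Sys.measure, z ξ = matAct Sys.P₁ (g ξ) + matAct (Sys.P₀ ξ) (v ξ))

/-- The graph of the operator `A = P₁ ∂/∂ξ H + P₀ H` on `L^p([a,b], 𝕂ⁿ)` with domain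
`{x | H x ∈ W^{1,p}, W_B [(H x)(b); (H x)(a)] = 0}`. -/
def OperatorA (Sys : HBCS 𝕜 n) (p : ENNReal) (x z : Sys.StateSpace p) : Prop :=
  ∃ v : ℝ → KVec 𝕜 n, Sys.MaxOperator p x z v ∧ bdryAct Sys.WB (v Sys.b) (v Sys.a) = 0

/-- The standing assumptions on the system. The generation property is required on
`L²([a,b], 𝕂ⁿ)`; being the generator of a strongly continuous semigroup does not change
under passage to an equivalent norm, in particular to the norm
`‖f‖² = (1/2) ∫ f* H f`. -/
structure StandingAssumptions (Sys : HBCS 𝕜 n) : Prop where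
  P₁_isUnit : IsUnit Sys.P₁
  P₁_selfAdjoint : Sys.P₁.IsHermitian
  P₀_bounded : ∀ i j, MemLp (fun ξ => Sys.P₀ ξ i j) ⊤ Sys.measure
  H_bounded : ∀ i j, MemLp (fun ξ => Sys.H ξ i j) ⊤ Sys.measure
  H_selfAdjoint : ∀ᵐ ξ ∂Sys.measure, (Sys.H ξ).IsHermitian
  H_coercive : ∃ m M : ℝ, 0 < m ∧ 0 < M ∧ ∀ᵐ ξ ∂Sys.measure,
    (Sys.H ξ - (m : 𝕜) • (1 : Matrix (Fin n) (Fin n) 𝕜)).PosSemidef ∧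
    ((M : 𝕜) • (1 : Matrix (Fin n) (Fin n) 𝕜) - Sys.H ξ).PosSemidef
  WB_fullRank : Sys.WB.rank = n
  WBC_fullRank : (Matrix.fromRows Sys.WB Sys.WC).rank = 2 * n
  generates : GeneratesC0Semigroup 𝕜 (Sys.OperatorA 2)

/-- The `C¹`-diagonalisation assumption: there are `C¹` matrix functions `S`, `H^D` on `[a,b]`,
with `S` pointwise invertible and `H^D` diagonal and positive, such that
`P₁ H = S⁻¹ P₁^D H^D S` with `P₁^D = diag(I_m, -I_{n-m})` for some `0 ≤ m ≤ n`. -/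
def DiagonalisationAssumption (Sys : HBCS 𝕜 n) : Prop :=
  ∃ (S HD : ℝ → Matrix (Fin n) (Fin n) 𝕜) (m : ℕ), m ≤ n ∧
    (∀ i j, ContDiffOn ℝ 1 (fun ξ => S ξ i j) (Icc Sys.a Sys.b)) ∧
    (∀ i j, ContDiffOn ℝ 1 (fun ξ => HD ξ i j) (Icc Sys.a Sys.b)) ∧
    (∀ ξ ∈ Icc Sys.a Sys.b, IsUnit (S ξ)) ∧
    (∀ ξ ∈ Icc Sys.a Sys.b, (HD ξ).IsDiag ∧ (HD ξ).PosDef) ∧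
    ∀ᵐ ξ ∂Sys.measure, Sys.P₁ * Sys.H ξ =
      (S ξ)⁻¹ * Matrix.diagonal (fun i : Fin n => if i.val < m then (1 : 𝕜) else -1) * HD ξ * S ξ

/-- `(u, x, y)` is a classical solution of the system on the state space `L^p([a,b], 𝕂ⁿ)`:
`u, y ∈ C([0,∞), 𝕂ⁿ)`, `x ∈ C¹([0,∞), L^p)`, and for every `t ≥ 0`
`x'(t) = P₁ ∂/∂ξ (H x(t)) + P₀ (H x(t))`, `u(t) = W_B [(H x(t))(b); (H x(t))(a)]` and
`y(t) = W_C [(H x(t))(b); (H x(t))(a)]`. -/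
structure IsClassicalSolution (Sys : HBCS 𝕜 n) (p : ENNReal) [Fact (1 ≤ p)]
    (u : ℝ → KVec 𝕜 n) (x : ℝ → Sys.StateSpace p) (y : ℝ → KVec 𝕜 n) : Prop where
  u_cont : ContinuousOn u (Ici 0)
  y_cont : ContinuousOn y (Ici 0)
  x_contDiff : ContDiffOn ℝ 1 x (Ici 0)
  eqn : ∀ t : ℝ, 0 ≤ t → ∃ v : ℝ → KVec 𝕜 n,
    Sys.MaxOperator p (x t) (derivWithin x (Ici 0) t) v ∧
    u t = bdryAct Sys.WB (v Sys.b) (v Sys.a) ∧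
    y t = bdryAct Sys.WC (v Sys.b) (v Sys.a)

end HBCS

end

noncomputable section

/-! In the characteristic variable `S x` the principal part decouples into scalar transport
equations with speeds `d i`, up to a bounded zero-order term (`HBCS.CharForm`). Components with
index below `m` enter at `b` and leave at `a`; the others travel the opposite way. Well-posedness
rests on one algebraic property: the input and the outgoing values together determine the incoming
values, that is, `p ↦ cf.boundary Sys.WB (p, 0)` is injective.

This property follows from generation on `L²` (`injective_of_generates`). If it fails, some
nontrivial combination of the outgoing values vanishes on the domain of `A`. Pair the state with
layers of width about `1 / l` at the exit points, combined with the same coefficients up to sign. By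
parts (`integral_layer`), the resulting functional `Φ` satisfies the adjoint eigenvalue equation for
`l` up to a bounded perturbation and an error `E` tending to zero, since the boundary terms cancel.
A generator forces `l ‖Φ‖ ≤ C ‖E‖` for large `l` (`exists_functional_bound`), yet `l Φ x₀` tends to
a nonzero number for a suitable fixed state `x₀`.

Given the property, a Lyapunov argument works directly in `L¹`. Weight the norm of each component by
an affine function equal to `1` at the entry and `r` at the exit. Along solutions the growth rate of
this norm is at most inflow minus `r` times outflow plus a multiple of the norm
(`exists_dissipation`). The inflow is at most `c₁` times input plus outflow, so `r = c₁ + 1` leaves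
one copy of the outflow with a negative sign. Grönwall then bounds the state and the time integral
of the outflow, hence the output. The `L¹` norm need not be differentiable, but norming functionals
bound its left difference quotients from above, which is all that `gronwall_of_left_slope` asks for.
-/

/-- `f` is absolutely continuous on `[a,b]` and `f'` is its (integrable) derivative almost
everywhere. -/
structure HasACDeriv {E : Type*} [NormedAddCommGroup E] [NormedSpace ℝ E] (a b : ℝ)
    (f f' : ℝ → E) : Prop where
  ac : AbsolutelyContinuousOnInterval f a b
  int : IntervalIntegrable f' volume a b
  deriv : ∀ᵐ x, x ∈ Ioo a b → HasDerivAt f (f' x) x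

/-! ### Calculus of absolutely continuous functions -/

section AC

variable {E F : Type*} [NormedAddCommGroup E] [NormedSpace ℝ E]
  [NormedAddCommGroup F] [NormedSpace ℝ F] {a b : ℝ}

theorem AbsolutelyContinuousOnInterval.of_dist_le {X Y : Type*} [PseudoMetricSpace X]
    [PseudoMetricSpace Y] {f : ℝ → X} {G : ℝ → Y} (K : ℝ)
    (hG : AbsolutelyContinuousOnInterval G a b)
    (h : ∀ x ∈ uIcc a b, ∀ y ∈ uIcc a b, dist (f x) (f y) ≤ K * dist (G x) (G y)) :
    AbsolutelyContinuousOnInterval f a b := by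
  unfold AbsolutelyContinuousOnInterval at hG ⊢
  apply squeeze_zero' ?_ ?_ (by simpa using hG.const_mul K)
  · exact Filter.Eventually.of_forall <| fun _ ↦ Finset.sum_nonneg (fun i hi ↦ dist_nonneg)
  rw [eventually_inf_principal]
  filter_upwards with (n, I) hnI
  rw [Finset.mul_sum]
  simp only [AbsolutelyContinuousOnInterval.disjWithin, mem_ofPred_eq] at hnI
  exact Finset.sum_le_sum fun i hi ↦ h _ (hnI.left i hi).1 _ (hnI.left i hi).2

/-- Increments are dominated by those of the primitive of `‖g‖`, which reduces the vector-valued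
case to the scalar one. -/
theorem IntervalIntegrable.absolutelyContinuousOnInterval_primitive {g : ℝ → E}
    (hg : IntervalIntegrable g volume a b) :
    AbsolutelyContinuousOnInterval (fun x ↦ ∫ s in a..x, g s) a b := by
  refine AbsolutelyContinuousOnInterval.of_dist_le 1
    (hg.norm.absolutelyContinuousOnInterval_intervalIntegral (c := a) left_mem_uIcc) ?_
  intro x hx y hy
  have hi : ∀ z ∈ uIcc a b, IntervalIntegrable g volume a z := fun z hz ↦
    hg.mono_set (uIcc_subset_uIcc_left hz)
  rw [one_mul, dist_eq_norm, Real.dist_eq,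
    intervalIntegral.integral_interval_sub_left (hi x hx) (hi y hy),
    intervalIntegral.integral_interval_sub_left (hi x hx).norm (hi y hy).norm]
  exact intervalIntegral.norm_integral_le_abs_integral_norm

/-- The difference of `f` and the primitive of `f'` is absolutely continuous with derivative zero
almost everywhere, hence constant. -/
theorem HasACDeriv.eq_integral [CompleteSpace E] {f f' : ℝ → E} (hab : a ≤ b) (h : HasACDeriv a b f f') :
    ∫ s in a..b, f' s = f b - f a := by
  have hp := h.int.absolutelyContinuousOnInterval_primitive
  have hd : ∀ᵐ x, x ∈ uIcc a b → HasDerivAt (fun x ↦ f x - ∫ s in a..x, f' s) 0 x := by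
    filter_upwards [Measure.ae_ne volume a, Measure.ae_ne volume b, h.deriv,
      h.int.ae_hasDerivAt_integral] with x h1 h2 h3 h4 hx
    have h5 := h4 hx a left_mem_uIcc
    rw [uIcc_of_le hab] at hx
    exact ((h3 ⟨lt_of_le_of_ne hx.1 h1.symm, lt_of_le_of_ne hx.2 h2⟩).sub h5).congr_deriv
      (sub_self _)
  obtain ⟨C, hC⟩ := (h.ac.sub hp).const_of_ae_hasDerivAt_zero hd
  have h1 := hC a left_mem_uIcc
  have h2 := hC b right_mem_uIcc
  simp only [Pi.sub_apply, intervalIntegral.integral_same, sub_zero] at h1 h2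
  rw [h1, ← h2]; abel

theorem HasSobolevDeriv.hasACDeriv [CompleteSpace E] {p : ENNReal} (hp : 1 ≤ p) (hab : a < b) {v g : ℝ → E}
    (h : HasSobolevDeriv p a b v g) : HasACDeriv a b v g := by
  have hint : IntervalIntegrable g volume a b := by
    rw [intervalIntegrable_iff_integrableOn_Icc_of_le hab.le]
    exact h.1.integrable hp
  refine ⟨AbsolutelyContinuousOnInterval.of_dist_le 1
    (hint.absolutelyContinuousOnInterval_primitive) ?_, hint, ?_⟩
  · intro x hx y hy
    rw [uIcc_of_le hab.le] at hx hy
    rw [h.2 x hx, h.2 y hy]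
    simp
  · filter_upwards [hint.ae_hasDerivAt_integral] with x hx hxI
    rw [uIcc_of_le hab.le] at hx
    have := (hx (Ioo_subset_Icc_self hxI) a (left_mem_Icc.2 hab.le)).const_add (v a)
    refine this.congr_of_eventuallyEq ?_
    filter_upwards [Ioo_mem_nhds hxI.1 hxI.2] with y hy
    exact h.2 y (Ioo_subset_Icc_self hy)

theorem HasACDeriv.clm_comp {f f' : ℝ → E} (L : E →L[ℝ] F) (h : HasACDeriv a b f f') :
    HasACDeriv a b (fun x ↦ L (f x)) (fun x ↦ L (f' x)) := by
  refine ⟨AbsolutelyContinuousOnInterval.of_dist_le ‖L‖ h.ac ?_, ?_, ?_⟩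
  · intro x _ y _
    exact L.dist_le_opNorm _ _
  · exact ⟨L.integrable_comp h.int.1, L.integrable_comp h.int.2⟩
  · filter_upwards [h.deriv] with x hx hxI
    exact L.hasFDerivAt.comp_hasDerivAt x (hx hxI)

theorem HasACDeriv.add {f f' g g' : ℝ → E} (hf : HasACDeriv a b f f') (hg : HasACDeriv a b g g') :
    HasACDeriv a b (fun x ↦ f x + g x) (fun x ↦ f' x + g' x) := by
  refine ⟨hf.ac.add hg.ac, hf.int.add hg.int, ?_⟩
  filter_upwards [hf.deriv, hg.deriv] with x h1 h2 hx
  exact (h1 hx).add (h2 hx)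

theorem HasACDeriv.const (c : E) : HasACDeriv a b (fun _ ↦ c) (fun _ ↦ 0) :=
  ⟨(LipschitzWith.const c).lipschitzOnWith.absolutelyContinuousOnInterval,
    intervalIntegrable_const, Eventually.of_forall fun x _ ↦ hasDerivAt_const x c⟩

theorem HasACDeriv.sum {ι : Type*} (s : Finset ι) {f f' : ι → ℝ → E}
    (h : ∀ i ∈ s, HasACDeriv a b (f i) (f' i)) :
    HasACDeriv a b (fun x ↦ ∑ i ∈ s, f i x) (fun x ↦ ∑ i ∈ s, f' i x) := by
  classical
  induction s using Finset.induction_on with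
  | empty => simpa using HasACDeriv.const (0 : E)
  | insert i s hi ih =>
    simp only [Finset.sum_insert hi]
    exact (h i (Finset.mem_insert_self i s)).add
      (ih fun j hj ↦ h j (Finset.mem_insert_of_mem hj))

theorem HasACDeriv.mul {A : Type*} [NormedField A] [NormedAlgebra ℝ A] {f f' g g' : ℝ → A}
    (hf : HasACDeriv a b f f') (hg : HasACDeriv a b g g') :
    HasACDeriv a b (fun x ↦ f x * g x) (fun x ↦ f' x * g x + f x * g' x) := by
  refine ⟨hf.ac.smul hg.ac, (hf.int.mul_continuousOn hg.ac.continuousOn).add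
    (hg.int.continuousOn_mul hf.ac.continuousOn), ?_⟩
  filter_upwards [hf.deriv, hg.deriv] with x h1 h2 hx
  exact (h1 hx).mul (h2 hx)

theorem ContDiffOn.hasACDeriv (hab : a < b) {f : ℝ → E} (hf : ContDiffOn ℝ 1 f (Icc a b)) :
    HasACDeriv a b f (derivWithin f (Icc a b)) := by
  refine ⟨?_, ?_, Eventually.of_forall fun x hx ↦ ?_⟩
  · exact ContDiffOn.absolutelyContinuousOnInterval (by rwa [uIcc_of_le hab.le])
  · apply ContinuousOn.intervalIntegrable
    rw [uIcc_of_le hab.le]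
    exact hf.continuousOn_derivWithin (uniqueDiffOn_Icc hab) le_rfl
  · exact ((hf.differentiableOn one_ne_zero x (Ioo_subset_Icc_self hx)).hasDerivWithinAt).hasDerivAt
      (Icc_mem_nhds hx.1 hx.2)

/-- The absolute value of an absolutely continuous function. -/
theorem HasACDeriv.norm {𝕜 : Type*} [RCLike 𝕜] (hab : a ≤ b) {w w' : ℝ → 𝕜}
    (h : HasACDeriv a b w w') :
    HasACDeriv a b (fun x ↦ ‖w x‖)
      (fun x ↦ RCLike.re ((starRingEnd 𝕜) (((‖w x‖⁻¹ : ℝ) : 𝕜) * w x) * w' x)) := by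
  have hac : AbsolutelyContinuousOnInterval (fun x ↦ ‖w x‖) a b := by
    refine AbsolutelyContinuousOnInterval.of_dist_le 1 h.ac fun x _ y _ ↦ ?_
    rw [one_mul]
    exact (dist_norm_norm_le (w x) (w y)).trans_eq (dist_eq_norm _ _).symm
  have hd : ∀ᵐ x, x ∈ Ioo a b → HasDerivAt (fun x ↦ ‖w x‖)
      (RCLike.re ((starRingEnd 𝕜) (((‖w x‖⁻¹ : ℝ) : 𝕜) * w x) * w' x)) x := by
    filter_upwards [h.deriv, hac.ae_differentiableAt] with x h1 h2 hx
    -- At a zero of `w` the norm has a minimum, so its derivative, where it exists, is `0`; the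
    -- formula agrees because `0⁻¹ = 0`.
    by_cases hw : w x = 0
    · have h3 := (h2 (by rw [uIcc_of_le hab]; exact Ioo_subset_Icc_self hx)).hasDerivAt
      have h4 : IsLocalMin (fun x ↦ ‖w x‖) x := Eventually.of_forall fun y ↦ by simp [hw]
      rw [h4.hasDerivAt_eq_zero h3] at h3
      simpa [hw] using h3
    · have hsq : HasDerivAt (fun x ↦ ‖w x‖ ^ 2)
          (2 * RCLike.re ((starRingEnd 𝕜) (w x) * w' x)) x := by
        have h3 := ((RCLike.conjCLE (K := 𝕜) : 𝕜 →L[ℝ] 𝕜).hasFDerivAt.comp_hasDerivAt x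
          (h1 hx)).mul (h1 hx)
        have h4 := (RCLike.reCLM (K := 𝕜)).hasFDerivAt.comp_hasDerivAt x h3
        refine (h4.congr_deriv ?_).congr_of_eventuallyEq (Eventually.of_forall fun y ↦ ?_)
        · simp
          ring
        · exact RCLike.norm_sq_eq_def.trans (by simp)
      have h5 := hsq.sqrt (by simpa using hw)
      simp only [Real.sqrt_sq (norm_nonneg _)] at h5
      refine h5.congr_deriv ?_
      have : ‖w x‖ ≠ 0 := by simpa using hw
      rw [map_mul (starRingEnd 𝕜), RCLike.conj_ofReal, mul_assoc, RCLike.re_ofReal_mul]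
      field_simp
  refine ⟨hac, hac.intervalIntegrable_deriv.congr_ae ?_, hd⟩
  rw [uIoc_of_le hab, Filter.EventuallyEq, ae_restrict_iff' measurableSet_Ioc]
  filter_upwards [hd, Measure.ae_ne volume b] with x h1 h2 hx
  exact (h1 ⟨hx.1, lt_of_le_of_ne hx.2 h2⟩).deriv

end AC

/-! ### Semigroups and an adjoint resolvent estimate for their generators -/

section Semigroup

variable {𝕜 X : Type*} [RCLike 𝕜] [NormedAddCommGroup X] [NormedSpace 𝕜 X]

/-- Otherwise `‖T (t k)‖` is unbounded along some `t k → 0`, while each orbit `T (t k) x` converges;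
this contradicts uniform boundedness. -/
theorem IsC0Semigroup.exists_bound [CompleteSpace X] {T : ℝ → X →L[𝕜] X} (hT : IsC0Semigroup T) :
    ∃ δ : ℝ, 0 < δ ∧ ∃ C : ℝ, 0 < C ∧ ∀ t ∈ Icc 0 δ, ‖T t‖ ≤ C := by
  by_contra! hcon
  have h1 : ∀ k : ℕ, ∃ t ∈ Icc (0 : ℝ) (1 / ((k : ℝ) + 1)), (k : ℝ) + 1 < ‖T t‖ := fun k ↦
    hcon _ (by positivity) _ (by positivity)
  choose t ht htn using h1
  have htend : Tendsto t atTop (𝓝 0) :=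
    squeeze_zero (fun k ↦ (ht k).1) (fun k ↦ (ht k).2) tendsto_one_div_add_atTop_nhds_zero_nat
  have hx : ∀ x : X, ∃ C, ∀ k, ‖T (t k) x‖ ≤ C := by
    intro x
    have hc : ContinuousWithinAt (fun s ↦ T s x) (Ici 0) 0 := by
      rw [← Ioi_insert, continuousWithinAt_insert_self]
      have := hT.strongly_continuous x
      rwa [ContinuousWithinAt, hT.map_zero]
    have h2 : Tendsto (fun k ↦ T (t k) x) atTop (𝓝 (T 0 x)) := hc.tendsto.comp
      (tendsto_nhdsWithin_iff.2 ⟨htend, Eventually.of_forall fun k ↦ (ht k).1⟩)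
    obtain ⟨C, hC⟩ := (Metric.isBounded_range_of_tendsto _ h2).exists_norm_le
    exact ⟨C, fun k ↦ hC _ (mem_range_self k)⟩
  obtain ⟨C, hC⟩ := banach_steinhaus hx
  obtain ⟨k, hk⟩ := exists_nat_gt C
  linarith [hC k, htn k]

/-- For `s < t`, factoring out `T s` bounds the increment by `C ‖T (t - s) x - x‖`, so right
continuity at `0` gives continuity from both sides. -/
theorem IsC0Semigroup.continuousOn {T : ℝ → X →L[𝕜] X} (hT : IsC0Semigroup T) {δ C : ℝ}
    (hC : 0 < C) (hb : ∀ t ∈ Icc 0 δ, ‖T t‖ ≤ C) (x : X) :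
    ContinuousOn (fun t ↦ T t x) (Icc 0 δ) := by
  have key : ∀ s ∈ Icc 0 δ, ∀ t ∈ Icc 0 δ, s < t → dist (T s x) (T t x) ≤ C * ‖T (t - s) x - x‖ := by
    intro s hs t ht hst
    have h1 : T t x = T s (T (t - s) x) := by
      have := hT.map_add s (t - s) hs.1 (by linarith)
      rw [add_sub_cancel] at this
      rw [this]; rfl
    rw [dist_comm, dist_eq_norm, h1, ← map_sub]
    exact (T s).le_of_opNorm_le (hb s hs) _
  rw [Metric.continuousOn_iff]
  intro t ht ε hε
  have h2 := Metric.tendsto_nhdsWithin_nhds.1 (hT.strongly_continuous x) (ε / C) (by positivity)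
  obtain ⟨η, hη, h3⟩ := h2
  refine ⟨η, hη, fun s hs hst ↦ ?_⟩
  have h4 : ∀ h, 0 < h → h < η → C * ‖T h x - x‖ < ε := by
    intro h h0 h1
    have := h3 (x := h) h0 (by rw [Real.dist_eq, sub_zero, abs_of_pos h0]; exact h1)
    rw [dist_eq_norm, lt_div_iff₀ hC] at this
    linarith
  rw [Real.dist_eq] at hst
  rcases lt_trichotomy s t with h | h | h
  · refine (key s hs t ht h).trans_lt (h4 _ (by linarith) ?_)
    linarith [neg_abs_le (s - t)]
  · simpa [h] using hε
  · rw [dist_comm]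
    refine (key t ht s hs h).trans_lt (h4 _ (by linarith) ?_)
    linarith [le_abs_self (s - t)]

theorem IsC0Semigroup.tendsto_quotient {T : ℝ → X →L[𝕜] X} (hT : IsC0Semigroup T) {x z : X}
    (h : Tendsto (fun h : ℝ => ((h : 𝕜)⁻¹) • (T h x - x)) (𝓝[>] 0) (𝓝 z)) {t : ℝ} (ht : 0 ≤ t) :
    Tendsto (fun h : ℝ => ((h : 𝕜)⁻¹) • (T h (T t x) - T t x)) (𝓝[>] 0) (𝓝 (T t z)) := by
  refine (((T t).continuous.tendsto z).comp h).congr' ?_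
  filter_upwards [self_mem_nhdsWithin] with s hs
  have h1 := hT.map_add s t (le_of_lt hs) ht
  have h2 := hT.map_add t s ht (le_of_lt hs)
  rw [add_comm, h1] at h2
  have h3 : T s (T t x) = T t (T s x) := congrArg (fun L : X →L[𝕜] X ↦ L x) h2
  simp [h3]

/-- The domain of the generator is dense. -/
theorem IsC0Semigroup.dense_domain [NormedSpace ℝ X] [IsScalarTower ℝ 𝕜 X] [CompleteSpace X]
    {T : ℝ → X →L[𝕜] X} (hT : IsC0Semigroup T) :
    Dense {x : X | ∃ z, Tendsto (fun h : ℝ => ((h : 𝕜)⁻¹) • (T h x - x)) (𝓝[>] 0) (𝓝 z)} := by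
  obtain ⟨δ, hδ, C, hC, hb⟩ := hT.exists_bound
  intro x
  -- Clamping time to `[0, δ]` makes the orbit continuous on the whole line.
  set F : ℝ → X := fun s ↦ T (max 0 (min s δ)) x with hF
  have hFc : Continuous F := (hT.continuousOn hC hb x).comp_continuous
    (by fun_prop) (fun s ↦ ⟨le_max_left _ _, max_le hδ.le (min_le_right _ _)⟩)
  have hFe : ∀ s ∈ Icc 0 δ, F s = T s x := fun s hs ↦ by
    simp only [hF]; rw [min_eq_left hs.2, max_eq_right hs.1]
  have hint : ∀ p q, IntervalIntegrable F volume p q := fun p q ↦ hFc.intervalIntegrable p q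
  have hder : ∀ t, HasDerivAt (fun t ↦ ∫ s in (0 : ℝ)..t, F s) (F t) t := fun t ↦
    intervalIntegral.integral_hasDerivAt_right (hint 0 t)
      hFc.stronglyMeasurable.stronglyMeasurableAtFilter hFc.continuousAt
  have hslope : ∀ t, Tendsto (fun h : ℝ ↦ ((h : 𝕜)⁻¹) • ∫ s in t..t + h, F s) (𝓝[>] 0)
      (𝓝 (F t)) := by
    intro t
    have h1 := (hder t).tendsto_slope_zero_right
    refine h1.congr fun h ↦ ?_
    rw [intervalIntegral.integral_interval_sub_left (hint _ _) (hint _ _),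
      ← RCLike.ofReal_inv, ← RCLike.real_smul_eq_coe_smul]
  have h0 : F 0 = x := by rw [hFe 0 ⟨le_rfl, hδ.le⟩, hT.map_zero]; rfl
  have hlim := hslope 0
  rw [h0] at hlim
  -- The means of the orbit over `[0, h]` converge to `x`. They lie in the domain because `T k`
  -- merely shifts the interval of integration, so only two short end pieces survive in the
  -- difference quotient.
  refine mem_closure_of_tendsto hlim ?_
  filter_upwards [Ioo_mem_nhdsGT hδ] with h hh
  refine ⟨(h : 𝕜)⁻¹ • (F h - F 0), ?_⟩
  have h2 : Tendsto (fun k : ℝ ↦ ((h : 𝕜)⁻¹) • (((k : 𝕜)⁻¹) • (∫ s in h..h + k, F s) -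
      ((k : 𝕜)⁻¹) • ∫ s in (0 : ℝ)..0 + k, F s)) (𝓝[>] 0) (𝓝 ((h : 𝕜)⁻¹ • (F h - F 0))) :=
    ((hslope h).sub (hslope 0)).const_smul _
  refine h2.congr' ?_
  filter_upwards [Ioo_mem_nhdsGT (sub_pos.2 hh.2)] with k hk
  have h3 : T k (∫ s in (0 : ℝ)..h, F s) = ∫ s in k..h + k, F s := by
    rw [← ContinuousLinearMap.intervalIntegral_comp_comm _ (hint _ _)]
    have : ∫ s in (0 : ℝ)..h, T k (F s) = ∫ s in (0 : ℝ)..h, F (s + k) := by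
      refine intervalIntegral.integral_congr fun s hs ↦ ?_
      rw [uIcc_of_le hh.1.le] at hs
      rw [hFe s ⟨hs.1, hs.2.trans hh.2.le⟩, hFe (s + k) ⟨by linarith [hs.1, hk.1], by
        linarith [hs.2, hk.2]⟩, add_comm s k, hT.map_add k s hk.1.le hs.1]
      rfl
    rw [this, intervalIntegral.integral_comp_add_right, zero_add]
  have h4 : (∫ s in k..h + k, F s) - ∫ s in (0 : ℝ)..h, F s =
      (∫ s in h..h + k, F s) - ∫ s in (0 : ℝ)..k, F s := by
    have e1 := intervalIntegral.integral_add_adjacent_intervals (hint 0 k) (hint k (h + k))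
    have e2 := intervalIntegral.integral_add_adjacent_intervals (hint 0 h) (hint h (h + k))
    rw [sub_eq_sub_iff_add_eq_add, ← add_comm (∫ s in (0 : ℝ)..k, F s), e1,
      ← add_comm (∫ s in (0 : ℝ)..h, F s), e2]
  simp only [zero_add, map_smul, h3]
  rw [← smul_sub, ← smul_sub, h4, smul_comm]

/-- Along the orbit, `exp (-l t) Φ (T t x)` has right derivative `-exp (-l t) (l Φ - Θ) (T t x)`.
Comparing its values at `0` and `δ` needs the semigroup only on `[0, δ]`, so no growth bound for
large times enters. -/
theorem IsC0Semigroup.norm_apply_le {T : ℝ → X →L[𝕜] X} (hT : IsC0Semigroup T) {δ C : ℝ}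
    (hδ : 0 < δ) (hC : 0 < C) (hb : ∀ t ∈ Icc 0 δ, ‖T t‖ ≤ C) {l : ℝ} (hl : 0 < l)
    (Φ Θ : X →L[𝕜] 𝕜)
    (hA : ∀ x z : X, Tendsto (fun h : ℝ => ((h : 𝕜)⁻¹) • (T h x - x)) (𝓝[>] 0) (𝓝 z) →
      Φ z = Θ x) {x z : X}
    (hxz : Tendsto (fun h : ℝ => ((h : 𝕜)⁻¹) • (T h x - x)) (𝓝[>] 0) (𝓝 z)) :
    ‖Φ x‖ ≤ (Real.exp (-l * δ) * C * ‖Φ‖ + C / l * ‖(l : 𝕜) • Φ - Θ‖) * ‖x‖ := by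
  set D : ℝ := C * ‖(l : 𝕜) • Φ - Θ‖ * ‖x‖ with hD
  have hder : ∀ t ∈ Ico 0 δ, HasDerivWithinAt (fun t ↦ Φ (T t x)) (Θ (T t x)) (Ici t) t := by
    intro t ht
    have h1 := hT.tendsto_quotient hxz ht.1
    rw [← hA _ _ h1, ← hasDerivWithinAt_Ioi_iff_Ici, hasDerivWithinAt_iff_tendsto_slope' (by simp)]
    have h2 : Tendsto (fun s : ℝ ↦ s - t) (𝓝[>] t) (𝓝[>] 0) := by
      refine tendsto_nhdsWithin_iff.2 ⟨?_, ?_⟩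
      · have : Tendsto (fun s : ℝ ↦ s - t) (𝓝 t) (𝓝 (t - t)) := tendsto_id.sub_const t
        rw [sub_self] at this
        exact this.mono_left nhdsWithin_le_nhds
      · filter_upwards [self_mem_nhdsWithin] with s hs using sub_pos.2 (mem_Ioi.1 hs)
    refine ((Φ.continuous.tendsto _).comp (h1.comp h2)).congr' ?_
    filter_upwards [self_mem_nhdsWithin] with s hs
    have h3 := hT.map_add (s - t) t (sub_pos.2 (mem_Ioi.1 hs)).le ht.1
    rw [sub_add_cancel] at h3
    rw [slope_def_module, h3, RCLike.real_smul_eq_coe_smul (K := 𝕜)]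
    simp
  have hexp : ∀ t, HasDerivAt (fun t : ℝ ↦ Real.exp (-l * t)) (Real.exp (-l * t) * (-l)) t :=
    fun t ↦ (by simpa using ((hasDerivAt_id t).const_mul (-l)).exp)
  have hg : ∀ t ∈ Ico 0 δ, HasDerivWithinAt (fun t ↦ Real.exp (-l * t) • Φ (T t x) - Φ x)
      (Real.exp (-l * t) • Θ (T t x) + (Real.exp (-l * t) * (-l)) • Φ (T t x)) (Ici t) t :=
    fun t ht ↦ (((hexp t).hasDerivWithinAt).smul (hder t ht)).sub_const _
  have hgc : ContinuousOn (fun t ↦ Real.exp (-l * t) • Φ (T t x) - Φ x) (Icc 0 δ) :=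
    ((by fun_prop : Continuous fun t : ℝ ↦ Real.exp (-l * t)).continuousOn.smul
      (Φ.continuous.comp_continuousOn (hT.continuousOn hC hb x))).sub continuousOn_const
  have hB : ∀ t, HasDerivAt (fun t : ℝ ↦ D / l * (1 - Real.exp (-l * t)))
      (D * Real.exp (-l * t)) t := by
    intro t
    refine (((hexp t).const_sub 1).const_mul (D / l)).congr_deriv ?_
    field_simp
  have hmain := image_norm_le_of_norm_deriv_right_le_deriv_boundary hgc hg
    (B := fun t : ℝ ↦ D / l * (1 - Real.exp (-l * t))) (B' := fun t ↦ D * Real.exp (-l * t))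
    (by simp [hT.map_zero]) hB (fun t ht ↦ by
      have h1 : Real.exp (-l * t) • Θ (T t x) + (Real.exp (-l * t) * (-l)) • Φ (T t x) =
          -(Real.exp (-l * t) • ((l : 𝕜) • Φ - Θ) (T t x)) := by
        simp only [RCLike.real_smul_eq_coe_smul (K := 𝕜), sub_apply, smul_apply, smul_eq_mul]
        push_cast
        ring
      rw [h1, norm_neg, norm_smul, Real.norm_eq_abs, Real.abs_exp, mul_comm]
      gcongr
      calc ‖((l : 𝕜) • Φ - Θ) (T t x)‖ ≤ ‖(l : 𝕜) • Φ - Θ‖ * ‖T t x‖ :=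
            ContinuousLinearMap.le_opNorm _ _
        _ ≤ ‖(l : 𝕜) • Φ - Θ‖ * (C * ‖x‖) := by
            gcongr
            exact (T t).le_of_opNorm_le (hb t (Ico_subset_Icc_self ht)) x
        _ = D := by rw [hD]; ring) (right_mem_Icc.2 hδ.le)
  have h5 : ‖Real.exp (-l * δ) • Φ (T δ x)‖ ≤ Real.exp (-l * δ) * C * ‖Φ‖ * ‖x‖ := by
    rw [norm_smul, Real.norm_eq_abs, Real.abs_exp, mul_assoc, mul_assoc]
    gcongr
    calc ‖Φ (T δ x)‖ ≤ ‖Φ‖ * ‖T δ x‖ := Φ.le_opNorm _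
      _ ≤ ‖Φ‖ * (C * ‖x‖) := by
          gcongr
          exact (T δ).le_of_opNorm_le (hb δ (right_mem_Icc.2 hδ.le)) x
      _ = C * (‖Φ‖ * ‖x‖) := by ring
  have h6 : D / l * (1 - Real.exp (-l * δ)) ≤ D / l := by
    have : 0 ≤ D / l := by positivity
    nlinarith [Real.exp_pos (-l * δ)]
  have h7 : ‖Φ x‖ ≤ ‖Real.exp (-l * δ) • Φ (T δ x)‖ + ‖Real.exp (-l * δ) • Φ (T δ x) - Φ x‖ := by
    have := norm_sub_le (Real.exp (-l * δ) • Φ (T δ x)) (Real.exp (-l * δ) • Φ (T δ x) - Φ x)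
    rwa [sub_sub_cancel] at this
  calc ‖Φ x‖ ≤ Real.exp (-l * δ) * C * ‖Φ‖ * ‖x‖ + D / l := by
        refine h7.trans (add_le_add h5 (le_trans ?_ h6))
        exact hmain
    _ = _ := by rw [hD]; ring

/-- A bounded functional `Φ` with `Φ ∘ A = l Φ - E + Φ ∘ B` on the domain of a generator `A`
satisfies `l ‖Φ‖ ≤ C ‖E‖` if `l` is large. -/
theorem GeneratesC0Semigroup.exists_functional_bound [NormedSpace ℝ X] [IsScalarTower ℝ 𝕜 X]
    [CompleteSpace X] {A : X → X → Prop} (hA : GeneratesC0Semigroup 𝕜 A) (B : X →L[𝕜] X) :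
    ∃ C : ℝ, ∀ᶠ l : ℝ in atTop, ∀ Φ E : X →L[𝕜] 𝕜,
      (∀ x z, A x z → Φ z = (l : 𝕜) * Φ x - E x + Φ (B x)) → l * ‖Φ‖ ≤ C * ‖E‖ := by
  obtain ⟨T, hT, hAT⟩ := hA
  obtain ⟨δ, hδ, C, hC, hb⟩ := hT.exists_bound
  refine ⟨2 * C, ?_⟩
  -- This is the coefficient of `‖Φ‖` on the right of `h3`. Once below `1 / 2` it is absorbed on the
  -- left, whence the factor in `2 * C`.
  have hlim : Tendsto (fun l : ℝ ↦ Real.exp (-l * δ) * C + C * ‖B‖ / l) atTop (𝓝 0) := by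
    have h1 : Tendsto (fun l : ℝ ↦ Real.exp (-l * δ)) atTop (𝓝 0) := by
      simp only [neg_mul]
      exact Real.tendsto_exp_neg_atTop_nhds_zero.comp (tendsto_id.atTop_mul_const hδ)
    simpa using (h1.mul_const C).add (tendsto_const_nhds.div_atTop tendsto_id)
  filter_upwards [hlim.eventually_lt_const (by norm_num : (0 : ℝ) < 1 / 2), eventually_gt_atTop 0]
    with l hl hl0 Φ E hΦ
  set q : ℝ := Real.exp (-l * δ) * C * ‖Φ‖ + C / l * ‖E - Φ.comp B‖ with hq
  have h1 : ‖Φ‖ ≤ q := by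
    refine Φ.opNorm_le_bound (by positivity) ?_
    have hcl : IsClosed {x | ‖Φ x‖ ≤ q * ‖x‖} := isClosed_le (by fun_prop) (by fun_prop)
    have hsub : {x : X | ∃ z, Tendsto (fun h : ℝ => ((h : 𝕜)⁻¹) • (T h x - x)) (𝓝[>] 0) (𝓝 z)} ⊆
        {x | ‖Φ x‖ ≤ q * ‖x‖} := by
      rintro x ⟨z, hz⟩
      have := hT.norm_apply_le hδ hC hb hl0 Φ ((l : 𝕜) • Φ - E + Φ.comp B) (fun x z hxz ↦ by
        rw [hΦ x z ((hAT x z).2 hxz)]; simp) hz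
      rwa [show (l : 𝕜) • Φ - ((l : 𝕜) • Φ - E + Φ.comp B) = E - Φ.comp B by abel] at this
    intro x
    exact closure_minimal hsub hcl (hT.dense_domain x)
  have h2 : ‖E - Φ.comp B‖ ≤ ‖E‖ + ‖Φ‖ * ‖B‖ :=
    (norm_sub_le _ _).trans (by gcongr; exact Φ.opNorm_comp_le B)
  have h3 : ‖Φ‖ ≤ (Real.exp (-l * δ) * C + C * ‖B‖ / l) * ‖Φ‖ + C / l * ‖E‖ := by
    calc ‖Φ‖ ≤ q := h1
      _ ≤ Real.exp (-l * δ) * C * ‖Φ‖ + C / l * (‖E‖ + ‖Φ‖ * ‖B‖) := by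
        rw [hq]; gcongr
      _ = _ := by ring
  have h4 : ‖Φ‖ ≤ 2 * (C / l * ‖E‖) := by nlinarith [norm_nonneg Φ]
  calc l * ‖Φ‖ ≤ l * (2 * (C / l * ‖E‖)) := by gcongr
    _ = 2 * C * ‖E‖ := by field_simp

end Semigroup

/-! ### Multiplication operators and pairings on `L^p` -/

section MulOp

variable {𝕜 : Type*} [RCLike 𝕜] {n : ℕ} {α : Type*} [MeasurableSpace α] {μ : Measure α}

theorem matAct_apply (M : Matrix (Fin n) (Fin n) 𝕜) (w : KVec 𝕜 n) (i : Fin n) :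
    matAct M w i = ∑ j, M i j * w j := rfl

theorem matAct_add (M : Matrix (Fin n) (Fin n) 𝕜) (v w : KVec 𝕜 n) :
    matAct M (v + w) = matAct M v + matAct M w := by
  ext i; simp [matAct_apply, mul_add, Finset.sum_add_distrib]

theorem matAct_smul (M : Matrix (Fin n) (Fin n) 𝕜) (c : 𝕜) (w : KVec 𝕜 n) :
    matAct M (c • w) = c • matAct M w := by
  ext i; simp [matAct_apply, Finset.mul_sum, mul_left_comm]

theorem matAct_mul (M N : Matrix (Fin n) (Fin n) 𝕜) (w : KVec 𝕜 n) :
    matAct (M * N) w = matAct M (matAct N w) := by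
  simp [matAct, Matrix.mulVec_mulVec]

theorem matAct_one (w : KVec 𝕜 n) : matAct (1 : Matrix (Fin n) (Fin n) 𝕜) w = w := by
  simp [matAct]

theorem matAct_sub_left (M N : Matrix (Fin n) (Fin n) 𝕜) (w : KVec 𝕜 n) :
    matAct (M - N) w = matAct M w - matAct N w := by
  simp [matAct, Matrix.sub_mulVec]

theorem norm_matAct_le (M : Matrix (Fin n) (Fin n) 𝕜) (w : KVec 𝕜 n) :
    ‖matAct M w‖ ≤ (∑ i, ∑ j, ‖M i j‖) * ‖w‖ := by
  have h : matAct M w = ∑ i, EuclideanSpace.single i (∑ j, M i j * w j) := by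
    ext k
    simp [matAct_apply, Finset.sum_apply, Pi.single_apply]
  rw [h, Finset.sum_mul]
  refine (norm_sum_le _ _).trans (Finset.sum_le_sum fun i _ ↦ ?_)
  rw [PiLp.norm_single, Finset.sum_mul]
  refine (norm_sum_le _ _).trans (Finset.sum_le_sum fun j _ ↦ ?_)
  rw [norm_mul]
  gcongr
  exact PiLp.norm_apply_le w j

theorem MeasureTheory.MemLp.exists_ae_bound {E : Type*} [NormedAddCommGroup E] {f : α → E}
    (hf : MemLp f ⊤ μ) : ∃ C : ℝ, 0 ≤ C ∧ ∀ᵐ x ∂μ, ‖f x‖ ≤ C := by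
  refine ⟨(eLpNormEssSup f μ).toReal, ENNReal.toReal_nonneg, ?_⟩
  have h : eLpNormEssSup f μ < ⊤ := by simpa using hf.2
  filter_upwards [ae_le_eLpNormEssSup (f := f) (μ := μ)] with x hx
  rw [← toReal_enorm]
  exact ENNReal.toReal_mono h.ne hx

theorem aestronglyMeasurable_kvec {f : α → KVec 𝕜 n}
    (h : ∀ i, AEStronglyMeasurable (fun x ↦ f x i) μ) : AEStronglyMeasurable f μ := by
  have : f = fun x ↦ ∑ i, f x i • EuclideanSpace.single i (1 : 𝕜) := by
    ext x k
    simp [Finset.sum_apply, Pi.single_apply]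
  rw [this]
  exact Finset.aestronglyMeasurable_fun_sum _ fun i _ ↦ (h i).smul_const _

theorem MeasureTheory.AEStronglyMeasurable.kvec_apply {f : α → KVec 𝕜 n}
    (h : AEStronglyMeasurable f μ) (i : Fin n) : AEStronglyMeasurable (fun x ↦ f x i) μ :=
  (PiLp.continuous_apply 2 (fun _ : Fin n ↦ 𝕜) i).comp_aestronglyMeasurable h

/-- Multiplication by a bounded matrix function is a bounded operator on `L^p`. -/
theorem exists_mulOp (p : ENNReal) [Fact (1 ≤ p)] {B : α → Matrix (Fin n) (Fin n) 𝕜}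
    (hB : ∀ i j, MemLp (fun ξ ↦ B ξ i j) ⊤ μ) :
    ∃ L : Lp (KVec 𝕜 n) p μ →L[𝕜] Lp (KVec 𝕜 n) p μ,
      ∀ x, ∀ᵐ ξ ∂μ, L x ξ = matAct (B ξ) (x ξ) := by
  choose C hC0 hC using fun i j ↦ (hB i j).exists_ae_bound
  have hbd : ∀ x : Lp (KVec 𝕜 n) p μ, ∀ᵐ ξ ∂μ,
      ‖matAct (B ξ) (x ξ)‖ ≤ (∑ i, ∑ j, C i j) * ‖x ξ‖ := by
    intro x
    filter_upwards [ae_all_iff.2 fun i ↦ ae_all_iff.2 (hC i)] with ξ hξ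
    refine (norm_matAct_le _ _).trans ?_
    gcongr with i _ j _
    exact hξ i j
  have hmeas : ∀ x : Lp (KVec 𝕜 n) p μ,
      AEStronglyMeasurable (fun ξ ↦ matAct (B ξ) (x ξ)) μ := by
    intro x
    refine aestronglyMeasurable_kvec fun i ↦ ?_
    simp only [matAct_apply]
    exact Finset.aestronglyMeasurable_fun_sum _ fun j _ ↦
      (hB i j).1.mul ((Lp.aestronglyMeasurable x).kvec_apply j)
  have hmem : ∀ x : Lp (KVec 𝕜 n) p μ, MemLp (fun ξ ↦ matAct (B ξ) (x ξ)) p μ := fun x ↦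
    (Lp.memLp x).of_le_mul (hmeas x) (hbd x)
  refine ⟨LinearMap.mkContinuous
    { toFun := fun x ↦ (hmem x).toLp _
      map_add' := fun x y ↦ ?_
      map_smul' := fun c x ↦ ?_ } (∑ i, ∑ j, C i j) fun x ↦ ?_, fun x ↦ (hmem x).coeFn_toLp⟩
  · rw [← MemLp.toLp_add]
    refine MemLp.toLp_congr _ _ ?_
    filter_upwards [Lp.coeFn_add x y] with ξ hξ
    rw [hξ]; simp [matAct_add]
  · rw [RingHom.id_apply, ← MemLp.toLp_const_smul]
    refine MemLp.toLp_congr _ _ ?_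
    filter_upwards [Lp.coeFn_smul c x] with ξ hξ
    rw [hξ]; simp [matAct_smul]
  · refine Lp.norm_le_mul_norm_of_ae_le_mul ?_
    filter_upwards [hbd x, (hmem x).coeFn_toLp] with ξ h1 h2
    refine le_trans (le_of_eq ?_) h1
    exact congrArg norm h2

theorem integrable_mul_Lp [IsFiniteMeasure μ] {p : ENNReal} [hp : Fact (1 ≤ p)] {θ : α → 𝕜}
    (hθ : MemLp θ ⊤ μ) (x : Lp (KVec 𝕜 n) p μ) (i : Fin n) :
    Integrable (fun ξ ↦ θ ξ * x ξ i) μ := by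
  obtain ⟨C, -, hC⟩ := hθ.exists_ae_bound
  refine Integrable.bdd_mul (c := C) ?_ hθ.1 hC
  have h := (Lp.memLp x).integrable hp.out
  refine h.mono (h.1.kvec_apply i) (Eventually.of_forall fun ξ ↦ ?_)
  exact PiLp.norm_apply_le _ _

/-- Pairing with a bounded vector function is a bounded functional on `L^p`. -/
theorem exists_pairing [IsFiniteMeasure μ] (p : ENNReal) [hp : Fact (1 ≤ p)] {θ : Fin n → α → 𝕜}
    (hθ : ∀ i, MemLp (θ i) ⊤ μ) :
    ∃ L : Lp (KVec 𝕜 n) p μ →L[𝕜] 𝕜, ∀ x, L x = ∑ i, ∫ ξ, θ i ξ * x ξ i ∂μ := by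
  choose C hC0 hC using fun i ↦ (hθ i).exists_ae_bound
  -- The Hölder constant of the inclusion of `L^p` in `L¹` for a finite measure.
  set K : ℝ := (μ univ ^ (1 / (1 : ENNReal).toReal - 1 / p.toReal)).toReal
  have hK : μ univ ^ (1 / (1 : ENNReal).toReal - 1 / p.toReal) ≠ ⊤ := by
    refine ENNReal.rpow_ne_top_of_nonneg ?_ (measure_ne_top _ _)
    rcases eq_or_ne p ⊤ with rfl | h
    · simp
    · have : 1 ≤ p.toReal := by
        rw [← ENNReal.toReal_one]; exact ENNReal.toReal_mono h hp.out
      simp only [ENNReal.toReal_one, one_div, inv_one, sub_nonneg]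
      exact inv_le_one_of_one_le₀ this
  have hint : ∀ x : Lp (KVec 𝕜 n) p μ, ∫ ξ, ‖x ξ‖ ∂μ ≤ ‖x‖ * K := by
    intro x
    rw [integral_norm_eq_lintegral_enorm (Lp.aestronglyMeasurable x), Lp.norm_def,
      ← ENNReal.toReal_mul, ← eLpNorm_one_eq_lintegral_enorm]
    exact ENNReal.toReal_mono (ENNReal.mul_ne_top (Lp.eLpNorm_ne_top x) hK)
      (eLpNorm_le_eLpNorm_mul_rpow_measure_univ hp.out (Lp.aestronglyMeasurable x))
  refine ⟨LinearMap.mkContinuous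
    { toFun := fun x ↦ ∑ i, ∫ ξ, θ i ξ * x ξ i ∂μ
      map_add' := fun x y ↦ ?_
      map_smul' := fun c x ↦ ?_ } (∑ i, C i * K) fun x ↦ ?_, fun x ↦ rfl⟩
  · rw [← Finset.sum_add_distrib]
    refine Finset.sum_congr rfl fun i _ ↦ ?_
    rw [← integral_add (integrable_mul_Lp (hθ i) x i) (integrable_mul_Lp (hθ i) y i)]
    refine integral_congr_ae ?_
    filter_upwards [Lp.coeFn_add x y] with ξ hξ
    rw [hξ]; simp [mul_add]
  · rw [RingHom.id_apply, Finset.smul_sum]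
    refine Finset.sum_congr rfl fun i _ ↦ ?_
    rw [← integral_smul]
    refine integral_congr_ae ?_
    filter_upwards [Lp.coeFn_smul c x] with ξ hξ
    rw [hξ]; simp [mul_left_comm]
  · change ‖∑ i, ∫ ξ, θ i ξ * x ξ i ∂μ‖ ≤ _
    rw [Finset.sum_mul]
    refine (norm_sum_le _ _).trans (Finset.sum_le_sum fun i _ ↦ ?_)
    have h := (Lp.memLp x).integrable hp.out
    calc ‖∫ ξ, θ i ξ * x ξ i ∂μ‖ ≤ ∫ ξ, C i * ‖x ξ‖ ∂μ := by
          refine norm_integral_le_of_norm_le (h.norm.const_mul _) ?_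
          filter_upwards [hC i] with ξ hξ
          rw [norm_mul]
          exact mul_le_mul hξ (PiLp.norm_apply_le _ _) (norm_nonneg _) (hC0 i)
      _ = C i * ∫ ξ, ‖x ξ‖ ∂μ := integral_const_mul _ _
      _ ≤ C i * (‖x‖ * K) := by gcongr; exacts [hC0 i, hint x]
      _ = C i * K * ‖x‖ := by ring

end MulOp

/-! ### Comparison and Grönwall inequalities for left slopes -/

section Gronwall

/-- Time reversal turns left slopes of `V` into right slopes of `s ↦ -V (T - s)`, to which the
comparison theorem for right slopes applies. -/
theorem le_add_integral_of_left_slope {V f : ℝ → ℝ} {T : ℝ} (hT : 0 ≤ T)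
    (hV : ContinuousOn V (Icc 0 T)) (hf : Continuous f)
    (h : ∀ t ∈ Ioc 0 T, ∀ r, f t < r → ∀ᶠ s in 𝓝[<] t, (V t - V s) / (t - s) < r) :
    V T ≤ V 0 + ∫ s in (0 : ℝ)..T, f s := by
  have hint : ∀ p q, IntervalIntegrable f volume p q := fun p q ↦ hf.intervalIntegrable p q
  have hder : ∀ t, HasDerivAt (fun t ↦ ∫ s in (0 : ℝ)..t, f s) (f t) t := fun t ↦
    intervalIntegral.integral_hasDerivAt_right (hint 0 t)
      hf.stronglyMeasurable.stronglyMeasurableAtFilter hf.continuousAt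
  have hB : ∀ s, HasDerivAt (fun s ↦ -V T + ((∫ r in (0 : ℝ)..T, f r) -
      ∫ r in (0 : ℝ)..(T - s), f r)) (f (T - s)) s := by
    intro s
    have h1 : HasDerivAt (fun s ↦ T - s) (-1) s := (hasDerivAt_id s).const_sub T
    refine ((((hder (T - s)).comp s h1).const_sub _).const_add (-V T)).congr_deriv ?_
    ring
  have hmain := image_le_of_liminf_slope_right_le_deriv_boundary (f := fun s ↦ -V (T - s))
    (a := 0) (b := T) (B := fun s ↦ -V T + ((∫ r in (0 : ℝ)..T, f r) -
      ∫ r in (0 : ℝ)..(T - s), f r)) (B' := fun s ↦ f (T - s))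
    ?_ (by simp) (fun s _ ↦ (hB s).continuousAt.continuousWithinAt)
    (fun s _ ↦ (hB s).hasDerivWithinAt) ?_ (right_mem_Icc.2 hT)
  · simp only [sub_self, intervalIntegral.integral_same, sub_zero] at hmain
    linarith
  · exact (hV.comp (by fun_prop) fun s hs ↦ ⟨by linarith [hs.2], by linarith [hs.1]⟩).neg
  · intro s hs r hr
    have h1 := h (T - s) ⟨by linarith [hs.2], by linarith [hs.1]⟩ r hr
    have h2 : Tendsto (fun z : ℝ ↦ T - z) (𝓝[>] s) (𝓝[<] (T - s)) := by
      refine tendsto_nhdsWithin_iff.2 ⟨?_, ?_⟩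
      · exact ((continuous_const.sub continuous_id).tendsto s).mono_left nhdsWithin_le_nhds
      · filter_upwards [self_mem_nhdsWithin] with z hz
        exact mem_Iio.2 (by linarith [mem_Ioi.1 hz])
    refine ((h2.eventually h1).mono fun z hz ↦ ?_).frequently
    rw [slope_def_field]
    convert! hz using 1
    congr 1 <;> ring

/-- A Grönwall inequality for functions whose left difference quotients are bounded. -/
theorem gronwall_of_left_slope {V o q : ℝ → ℝ} {C T : ℝ} (hT : 0 ≤ T) (hC : 0 ≤ C)
    (hV : ContinuousOn V (Icc 0 T)) (ho : ContinuousOn o (Icc 0 T)) (hq : ContinuousOn q (Icc 0 T))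
    (ho0 : ∀ t ∈ Icc 0 T, 0 ≤ o t) (hq0 : ∀ t ∈ Icc 0 T, 0 ≤ q t)
    (h : ∀ t ∈ Ioc 0 T, ∀ r, q t - o t + C * V t < r →
      ∀ᶠ s in 𝓝[<] t, (V t - V s) / (t - s) < r) :
    V T + ∫ s in (0 : ℝ)..T, o s ≤ Real.exp (C * T) * (V 0 + ∫ s in (0 : ℝ)..T, q s) := by
  set V' := IccExtend hT ((Icc 0 T).domRestrict V) with hV'
  set o' := IccExtend hT ((Icc 0 T).domRestrict o) with ho'
  set q' := IccExtend hT ((Icc 0 T).domRestrict q) with hq'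
  have hVc : Continuous V' := hV.domRestrict.Icc_extend'
  have hoc : Continuous o' := ho.domRestrict.Icc_extend'
  have hqc : Continuous q' := hq.domRestrict.Icc_extend'
  have eV : ∀ t ∈ Icc 0 T, V' t = V t := fun t ht ↦ IccExtend_of_mem hT _ ht
  have eo : ∀ t ∈ Icc 0 T, o' t = o t := fun t ht ↦ IccExtend_of_mem hT _ ht
  have eq : ∀ t ∈ Icc 0 T, q' t = q t := fun t ht ↦ IccExtend_of_mem hT _ ht
  have hint : ∀ {f : ℝ → ℝ}, Continuous f → ∀ p q, IntervalIntegrable f volume p q :=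
    fun hf p q ↦ hf.intervalIntegrable p q
  have hder : ∀ {f : ℝ → ℝ}, Continuous f → ∀ t,
      HasDerivAt (fun t ↦ ∫ s in (0 : ℝ)..t, f s) (f t) t := fun hf t ↦
    intervalIntegral.integral_hasDerivAt_right (hint hf 0 t)
      hf.stronglyMeasurable.stronglyMeasurableAtFilter hf.continuousAt
  set φ : ℝ → ℝ := fun t ↦ V 0 + (∫ s in (0 : ℝ)..t, q' s) + C * ∫ s in (0 : ℝ)..t, V' s with hφ
  have hVφ : ∀ t ∈ Icc 0 T, V t + ∫ s in (0 : ℝ)..t, o' s ≤ φ t := by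
    intro t ht
    have h1 := le_add_integral_of_left_slope (f := fun s ↦ q' s - o' s + C * V' s) ht.1
      (hV.mono (Icc_subset_Icc_right ht.2)) (by fun_prop) (fun s hs r hr ↦ by
        have hs' : s ∈ Icc 0 T := ⟨hs.1.le, hs.2.trans ht.2⟩
        simp only [eV s hs', eo s hs', eq s hs'] at hr
        exact h s ⟨hs.1, hs'.2⟩ r hr)
    rw [intervalIntegral.integral_add ((hint hqc _ _).sub (hint hoc _ _))
      ((hint hVc _ _).const_mul C), intervalIntegral.integral_sub (hint hqc _ _) (hint hoc _ _),
      intervalIntegral.integral_const_mul] at h1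
    simp only [hφ]
    linarith
  have hφd : ∀ t, HasDerivAt φ (q' t + C * V' t) t := fun t ↦
    ((hder hqc t).const_add (V 0)).add ((hder hVc t).const_mul C)
  have hexp : ∀ t, HasDerivAt (fun t : ℝ ↦ Real.exp (-C * t)) (Real.exp (-C * t) * (-C)) t :=
    fun t ↦ (by simpa using ((hasDerivAt_id t).const_mul (-C)).exp)
  -- On `[0, T]` the derivative of `η` is `-C exp (-C t) (φ - V) - (1 - exp (-C t)) q`. It is
  -- nonpositive because `V ≤ φ`, by `hVφ` and the sign of `o`.
  set η : ℝ → ℝ := fun t ↦ Real.exp (-C * t) * φ t - ∫ s in (0 : ℝ)..t, q' s with hη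
  have hηd : ∀ t, HasDerivAt η (Real.exp (-C * t) * (-C) * φ t +
      Real.exp (-C * t) * (q' t + C * V' t) - q' t) t := fun t ↦
    ((hexp t).mul (hφd t)).sub (hder hqc t)
  have hanti : AntitoneOn η (Icc 0 T) := by
    refine antitoneOn_of_deriv_nonpos (convex_Icc 0 T)
      (fun t _ ↦ (hηd t).continuousAt.continuousWithinAt)
      (fun t _ ↦ (hηd t).differentiableAt.differentiableWithinAt) fun t ht ↦ ?_
    have ht' : t ∈ Icc 0 T := interior_subset ht
    rw [(hηd t).deriv, eV t ht', eq t ht']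
    have h1 := hVφ t ht'
    have h2 : 0 ≤ ∫ s in (0 : ℝ)..t, o' s := intervalIntegral.integral_nonneg ht'.1 fun s hs ↦ by
      have hs' : s ∈ Icc 0 T := ⟨hs.1, hs.2.trans ht'.2⟩
      rw [eo s hs']; exact ho0 s hs'
    have h3 : Real.exp (-C * t) ≤ 1 := by
      rw [Real.exp_le_one_iff]; nlinarith [ht'.1]
    have h4 : 0 ≤ C * (φ t - V t) := mul_nonneg hC (by linarith)
    nlinarith [Real.exp_pos (-C * t), hq0 t ht', mul_nonneg (Real.exp_pos (-C * t)).le h4]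
  have h1 := hanti (left_mem_Icc.2 hT) (right_mem_Icc.2 hT) hT
  have h2 := hVφ T (right_mem_Icc.2 hT)
  have e1 : ∫ s in (0 : ℝ)..T, q' s = ∫ s in (0 : ℝ)..T, q s :=
    intervalIntegral.integral_congr fun s hs ↦ eq s (by rwa [uIcc_of_le hT] at hs)
  have e2 : ∫ s in (0 : ℝ)..T, o' s = ∫ s in (0 : ℝ)..T, o s :=
    intervalIntegral.integral_congr fun s hs ↦ eo s (by rwa [uIcc_of_le hT] at hs)
  simp only [hη, mul_zero, neg_zero, neg_mul, Real.exp_zero, one_mul,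
    intervalIntegral.integral_same, sub_zero, e1] at h1
  have e3 : φ 0 = V 0 := by simp [hφ]
  rw [e3] at h1
  rw [e2] at h2
  refine h2.trans ?_
  have h5 : Real.exp (-(C * T)) * φ T ≤ V 0 + ∫ s in (0 : ℝ)..T, q s := by linarith
  calc φ T = Real.exp (C * T) * (Real.exp (-(C * T)) * φ T) := by
        rw [← mul_assoc, ← Real.exp_add]; simp
    _ ≤ _ := by gcongr

end Gronwall

/-! ### Characteristic variables and boundary data -/

section Reduction

variable {𝕜 : Type*} [RCLike 𝕜] {n : ℕ}

theorem ContinuousOn.memLp_top_restrict_Icc {E : Type*} [NormedAddCommGroup E] {a b : ℝ}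
    {f : ℝ → E} (hf : ContinuousOn f (Icc a b)) : MemLp f ⊤ (volume.restrict (Icc a b)) := by
  obtain ⟨C, hC⟩ := isCompact_Icc.exists_bound_of_continuousOn hf
  refine memLp_top_of_bound (hf.aestronglyMeasurable_of_isCompact isCompact_Icc measurableSet_Icc)
    C ?_
  filter_upwards [ae_restrict_mem measurableSet_Icc] with x hx using hC x hx

theorem memLp_top_matrix_mul {α : Type*} [MeasurableSpace α] {μ : Measure α}
    {A B : α → Matrix (Fin n) (Fin n) 𝕜} (hA : ∀ i j, MemLp (fun x ↦ A x i j) ⊤ μ)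
    (hB : ∀ i j, MemLp (fun x ↦ B x i j) ⊤ μ) (i j : Fin n) :
    MemLp (fun x ↦ (A x * B x) i j) ⊤ μ := by
  simp only [Matrix.mul_apply]
  exact memLp_finsetSum _ fun k _ ↦ (hB k j).mul' (hA i k)

theorem continuousOn_matrix_inv_apply {s : Set ℝ} {S : ℝ → Matrix (Fin n) (Fin n) 𝕜}
    (hS : ∀ i j, ContinuousOn (fun x ↦ S x i j) s) (hu : ∀ x ∈ s, IsUnit (S x)) (i j : Fin n) :
    ContinuousOn (fun x ↦ (S x)⁻¹ i j) s := by
  have hS' : ContinuousOn S s := continuousOn_pi.2 fun i ↦ continuousOn_pi.2 (hS i)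
  have hdet : ContinuousOn (fun x ↦ (S x).det) s :=
    (continuous_id.matrix_det).comp_continuousOn hS'
  have hadj : ContinuousOn (fun x ↦ (S x).adjugate i j) s :=
    ((continuous_id.matrix_adjugate).matrix_elem i j).comp_continuousOn hS'
  have : (fun x ↦ (S x)⁻¹ i j) = fun x ↦ (S x).det⁻¹ * (S x).adjugate i j := by
    ext x
    rw [Matrix.inv_def, Ring.inverse_eq_inv', Matrix.smul_apply, smul_eq_mul]
  rw [this]
  refine (hdet.inv₀ fun x hx ↦ ?_).mul hadj
  exact ((Matrix.isUnit_iff_isUnit_det _).1 (hu x hx)).ne_zero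

/-- The sign of the `i`-th characteristic speed. -/
def charSign (m : ℕ) (i : Fin n) : ℝ := if i.val < m then 1 else -1

/-- The vector with the entries of `p` at the indices below `m` and of `q` at the others. -/
def mixVec (m : ℕ) (p q : KVec 𝕜 n) : KVec 𝕜 n :=
  WithLp.toLp 2 fun i ↦ if i.val < m then p i else q i

theorem mixVec_apply (m : ℕ) (p q : KVec 𝕜 n) (i : Fin n) :
    mixVec m p q i = if i.val < m then p i else q i := rfl

/-- Sorting by direction of travel is an involution, so the endpoint values are recovered from the
incoming and outgoing ones. -/
theorem mixVec_mixVec (m : ℕ) (p q : KVec 𝕜 n) : mixVec m (mixVec m p q) (mixVec m q p) = p := by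
  ext i; simp only [mixVec_apply]; split_ifs <;> rfl

theorem bdryAct_apply (W : Matrix (Fin n) (Fin n ⊕ Fin n) 𝕜) (p q : KVec 𝕜 n) (i : Fin n) :
    bdryAct W p q i = (∑ j, W i (Sum.inl j) * p j) + ∑ j, W i (Sum.inr j) * q j := by
  simp [bdryAct, Matrix.mulVec, dotProduct]

/-- `P₁ H` in characteristic form: the transformed variable `S x` solves a hyperbolic system with
diagonal principal part with speeds `± d i` and bounded zero order coefficient `R`. -/
structure HBCS.CharForm (Sys : HBCS 𝕜 n) where
  S : ℝ → Matrix (Fin n) (Fin n) 𝕜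
  R : ℝ → Matrix (Fin n) (Fin n) 𝕜
  d : Fin n → ℝ → ℝ
  m : ℕ
  S_cont : ∀ i j, ContinuousOn (fun ξ ↦ S ξ i j) (Icc Sys.a Sys.b)
  S_unit : ∀ ξ ∈ Icc Sys.a Sys.b, IsUnit (S ξ)
  R_bounded : ∀ i j, MemLp (fun ξ ↦ R ξ i j) ⊤ Sys.measure
  d_cont : ∀ i, ContinuousOn (d i) (Icc Sys.a Sys.b)
  d_pos : ∀ i, ∀ ξ ∈ Icc Sys.a Sys.b, 0 < d i ξ
  P₁_unit : IsUnit Sys.P₁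
  char : ∀ (p : ENNReal) [Fact (1 ≤ p)] (x z : Sys.StateSpace p) (v : ℝ → KVec 𝕜 n),
    Sys.MaxOperator p x z v → ∀ i, ∃ w' : ℝ → 𝕜,
      HasACDeriv Sys.a Sys.b (fun ξ ↦ matAct (S ξ * Sys.P₁) (v ξ) i) w' ∧
      (∀ᵐ ξ ∂Sys.measure, matAct (S ξ * Sys.P₁) (v ξ) i =
        ((charSign m i * d i ξ : ℝ) : 𝕜) * matAct (S ξ) (x ξ) i) ∧
      ∀ᵐ ξ ∂Sys.measure, matAct (S ξ) (z ξ) i = w' ξ + matAct (R ξ) (x ξ) i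

/-- The product rule is applied to `S P₁ v`, with `v` the absolutely continuous representative of `H
x`; the extra term `S' P₁ v` goes into `R`. Diagonalisation turns `S P₁ H` into a diagonal matrix
times `S`. All exponents are treated at once: generation is exploited for `p = 2`, the estimate is
proved for `p = 1`. -/
theorem HBCS.DiagonalisationAssumption.nonempty_charForm {Sys : HBCS 𝕜 n}
    (hSys : Sys.StandingAssumptions) (hD : Sys.DiagonalisationAssumption) :
    Nonempty Sys.CharForm := by
  obtain ⟨S, HD, m, -, hS, hHD, hSu, hHDp, hP⟩ := hD
  set S' : ℝ → Matrix (Fin n) (Fin n) 𝕜 := fun ξ ↦ Matrix.of fun i j ↦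
    derivWithin (fun ξ ↦ S ξ i j) (Icc Sys.a Sys.b) ξ with hS'
  have hmem : ∀ {f : ℝ → 𝕜}, ContinuousOn f (Icc Sys.a Sys.b) → MemLp f ⊤ Sys.measure :=
    fun hf ↦ hf.memLp_top_restrict_Icc
  have hSm : ∀ i j, MemLp (fun ξ ↦ S ξ i j) ⊤ Sys.measure := fun i j ↦ hmem (hS i j).continuousOn
  have hSm' : ∀ i j, MemLp (fun ξ ↦ S' ξ i j) ⊤ Sys.measure := fun i j ↦
    hmem ((hS i j).continuousOn_derivWithin (uniqueDiffOn_Icc Sys.hab) le_rfl)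
  have hPm : ∀ i j, MemLp (fun _ : ℝ ↦ Sys.P₁ i j) ⊤ Sys.measure := fun i j ↦
    hmem continuousOn_const
  have hHDre : ∀ i, ∀ ξ ∈ Icc Sys.a Sys.b, 0 < RCLike.re (HD ξ i i) ∧
      HD ξ i i = ((RCLike.re (HD ξ i i) : ℝ) : 𝕜) := by
    intro i ξ hξ
    have h1 := RCLike.pos_iff.1 ((hHDp ξ hξ).2.diag_pos (i := i))
    refine ⟨h1.1, ?_⟩
    conv_lhs => rw [← RCLike.re_add_im (HD ξ i i), h1.2]
    simp
  refine ⟨{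
    S := S
    R := fun ξ ↦ (S ξ * Sys.P₀ ξ - S' ξ * Sys.P₁) * Sys.H ξ
    d := fun i ξ ↦ RCLike.re (HD ξ i i)
    m := m
    S_cont := fun i j ↦ (hS i j).continuousOn
    S_unit := hSu
    R_bounded := ?_
    d_cont := fun i ↦ RCLike.continuous_re.comp_continuousOn (hHD i i).continuousOn
    d_pos := fun i ξ hξ ↦ (hHDre i ξ hξ).1
    P₁_unit := hSys.P₁_isUnit
    char := ?_ }⟩
  · refine memLp_top_matrix_mul (fun i j ↦ ?_) hSys.H_bounded
    exact (memLp_top_matrix_mul hSm hSys.P₀_bounded i j).sub (memLp_top_matrix_mul hSm' hPm i j)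
  · rintro p hp x z v ⟨g, hvg, hv, hz⟩ i
    have hvac := hvg.hasACDeriv hp.out Sys.hab
    refine ⟨fun ξ ↦ matAct (S' ξ * Sys.P₁) (v ξ) i + matAct (S ξ * Sys.P₁) (g ξ) i, ?_, ?_, ?_⟩
    · simp only [matAct_apply, ← Finset.sum_add_distrib]
      refine HasACDeriv.sum _ fun k _ ↦ HasACDeriv.mul ?_ ?_
      · simp only [Matrix.mul_apply]
        refine HasACDeriv.sum _ fun j _ ↦ ?_
        have := ((hS i j).hasACDeriv Sys.hab).mul (HasACDeriv.const (Sys.P₁ j k))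
        simpa only [mul_zero, add_zero, hS', Matrix.of_apply] using this
      · exact hvac.clm_comp ((PiLp.proj 2 (fun _ : Fin n ↦ 𝕜) k : KVec 𝕜 n →L[𝕜] 𝕜).restrictScalars ℝ)
    · filter_upwards [hv, hP, ae_restrict_mem measurableSet_Icc] with ξ h1 h2 hξ
      have hu := (Matrix.isUnit_iff_isUnit_det _).1 (hSu ξ hξ)
      have hdiag : HD ξ = Matrix.diagonal fun i ↦ HD ξ i i := ((hHDp ξ hξ).1.diagonal_diag).symm
      have h3 : S ξ * Sys.P₁ * Sys.H ξ = Matrix.diagonal (fun i : Fin n ↦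
          (if i.val < m then (1 : 𝕜) else -1) * HD ξ i i) * S ξ := by
        rw [Matrix.mul_assoc, h2, ← Matrix.mul_assoc, ← Matrix.mul_assoc, ← Matrix.mul_assoc,
          Matrix.mul_nonsing_inv _ hu, Matrix.one_mul]
        conv_lhs => rw [hdiag]
        rw [Matrix.diagonal_mul_diagonal]
      rw [h1, ← matAct_mul, h3, matAct_mul, RCLike.ofReal_mul, ← (hHDre i ξ hξ).2]
      simp only [matAct, Matrix.mulVec_diagonal, charSign]
      split_ifs <;> simp
    · filter_upwards [hv, hz] with ξ h1 h2
      rw [matAct_mul _ (Sys.H ξ), ← h1, matAct_sub_left, h2, matAct_add, ← matAct_mul,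
        ← matAct_mul]
      simp only [PiLp.add_apply, PiLp.sub_apply]
      ring

namespace HBCS.CharForm

variable {Sys : HBCS 𝕜 n} (cf : Sys.CharForm)

/-- The boundary values of the characteristic variables at the points where they enter. -/
def incoming (v : ℝ → KVec 𝕜 n) : KVec 𝕜 n :=
  mixVec cf.m (matAct (cf.S Sys.b * Sys.P₁) (v Sys.b)) (matAct (cf.S Sys.a * Sys.P₁) (v Sys.a))

/-- The boundary values of the characteristic variables at the points where they leave. -/
def outgoing (v : ℝ → KVec 𝕜 n) : KVec 𝕜 n :=
  mixVec cf.m (matAct (cf.S Sys.a * Sys.P₁) (v Sys.a)) (matAct (cf.S Sys.b * Sys.P₁) (v Sys.b))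

/-- The boundary operator in terms of the incoming and the outgoing values. -/
def boundary (W : Matrix (Fin n) (Fin n ⊕ Fin n) 𝕜) :
    KVec 𝕜 n × KVec 𝕜 n →ₗ[𝕜] KVec 𝕜 n where
  toFun pq := bdryAct W (matAct (cf.S Sys.b * Sys.P₁)⁻¹ (mixVec cf.m pq.1 pq.2))
    (matAct (cf.S Sys.a * Sys.P₁)⁻¹ (mixVec cf.m pq.2 pq.1))
  map_add' x y := by
    have h : ∀ p q p' q' : KVec 𝕜 n, mixVec cf.m (p + p') (q + q') =
        mixVec cf.m p q + mixVec cf.m p' q' := fun p q p' q' ↦ by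
      ext i; simp only [mixVec_apply, PiLp.add_apply]; split_ifs <;> rfl
    ext i
    simp only [Prod.fst_add, Prod.snd_add, h, matAct_add, bdryAct_apply, PiLp.add_apply, mul_add,
      Finset.sum_add_distrib]
    ring
  map_smul' c x := by
    have h : ∀ p q : KVec 𝕜 n, mixVec cf.m (c • p) (c • q) = c • mixVec cf.m p q := fun p q ↦ by
      ext i; simp only [mixVec_apply, PiLp.smul_apply]; split_ifs <;> rfl
    ext i
    simp only [Prod.smul_fst, Prod.smul_snd, h, matAct_smul, bdryAct_apply, PiLp.smul_apply,
      smul_eq_mul, mul_left_comm _ c, ← Finset.mul_sum, RingHom.id_apply]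
    ring

theorem isUnit_det_boundary {ξ : ℝ} (hξ : ξ ∈ Icc Sys.a Sys.b) :
    IsUnit (cf.S ξ * Sys.P₁).det :=
  (Matrix.isUnit_iff_isUnit_det _).1 ((cf.S_unit ξ hξ).mul cf.P₁_unit)

theorem boundary_incoming_outgoing (W : Matrix (Fin n) (Fin n ⊕ Fin n) 𝕜) (v : ℝ → KVec 𝕜 n) :
    cf.boundary W (cf.incoming v, cf.outgoing v) = bdryAct W (v Sys.b) (v Sys.a) := by
  change bdryAct W (matAct _ (mixVec cf.m (cf.incoming v) (cf.outgoing v)))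
    (matAct _ (mixVec cf.m (cf.outgoing v) (cf.incoming v))) = _
  rw [incoming, outgoing, mixVec_mixVec, mixVec_mixVec, ← matAct_mul, ← matAct_mul,
    Matrix.nonsing_inv_mul _ (cf.isUnit_det_boundary (right_mem_Icc.2 Sys.hab.le)),
    Matrix.nonsing_inv_mul _ (cf.isUnit_det_boundary (left_mem_Icc.2 Sys.hab.le)), matAct_one,
    matAct_one]

theorem boundary_surjective (hW : Sys.WB.rank = n) :
    Function.Surjective (cf.boundary Sys.WB) := by
  intro u
  have h1 : LinearMap.range Sys.WB.mulVecLin = ⊤ := by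
    apply Submodule.eq_top_of_finrank_eq
    rw [← Matrix.rank, hW]; simp
  obtain ⟨r, hr⟩ := LinearMap.range_eq_top.1 h1 u.ofLp
  set vb : KVec 𝕜 n := WithLp.toLp 2 fun i ↦ r (Sum.inl i)
  set va : KVec 𝕜 n := WithLp.toLp 2 fun i ↦ r (Sum.inr i)
  have hne : Sys.a ≠ Sys.b := Sys.hab.ne
  -- Only the two endpoint values matter here, so a two-valued function realises arbitrary boundary
  -- data.
  refine ⟨(cf.incoming fun ξ ↦ if ξ = Sys.b then vb else va,
    cf.outgoing fun ξ ↦ if ξ = Sys.b then vb else va), ?_⟩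
  rw [boundary_incoming_outgoing, if_pos rfl, if_neg hne, bdryAct]
  have : Sum.elim vb.ofLp va.ofLp = r := by ext i; cases i <;> rfl
  rw [this]
  ext i
  exact congrFun hr i

end HBCS.CharForm

/-- Input and output determine the boundary values. -/
theorem HBCS.exists_boundary_of_input_output (Sys : HBCS 𝕜 n)
    (h : (Matrix.fromRows Sys.WB Sys.WC).rank = 2 * n) :
    ∃ G : KVec 𝕜 n × KVec 𝕜 n →ₗ[𝕜] KVec 𝕜 n × KVec 𝕜 n, ∀ p q,
      G (bdryAct Sys.WB p q, bdryAct Sys.WC p q) = (p, q) := by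
  let L : (Fin n ⊕ Fin n → 𝕜) →ₗ[𝕜] (Fin n ⊕ Fin n → 𝕜) :=
    (Matrix.fromRows Sys.WB Sys.WC).mulVecLin
  have h1 : LinearMap.range L = ⊤ := by
    apply Submodule.eq_top_of_finrank_eq
    have : Module.finrank 𝕜 (LinearMap.range L) = 2 * n := h
    rw [this]; simp [two_mul]
  have h2 : LinearMap.ker L = ⊥ :=
    LinearMap.ker_eq_bot.2 (LinearMap.injective_iff_surjective.2 (LinearMap.range_eq_top.1 h1))
  obtain ⟨G, hG⟩ := L.exists_leftInverse_of_injective h2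
  refine ⟨{ toFun := fun uy ↦ (WithLp.toLp 2 fun i ↦ G (Sum.elim uy.1.ofLp uy.2.ofLp) (Sum.inl i),
      WithLp.toLp 2 fun i ↦ G (Sum.elim uy.1.ofLp uy.2.ofLp) (Sum.inr i))
            map_add' := fun x y ↦ ?_
            map_smul' := fun c x ↦ ?_ }, fun p q ↦ ?_⟩
  · have : Sum.elim (x + y).1.ofLp (x + y).2.ofLp = Sum.elim x.1.ofLp x.2.ofLp +
        Sum.elim y.1.ofLp y.2.ofLp := by ext i; cases i <;> rfl
    simp only [this, map_add]
    rfl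
  · have : Sum.elim (c • x).1.ofLp (c • x).2.ofLp = c • Sum.elim x.1.ofLp x.2.ofLp := by
      ext i; cases i <;> rfl
    simp only [this, map_smul]
    rfl
  · have h3 : Sum.elim (bdryAct Sys.WB p q).ofLp (bdryAct Sys.WC p q).ofLp =
        L (Sum.elim p.ofLp q.ofLp) := by
      ext i; cases i <;> rfl
    have h4 : G (L (Sum.elim p.ofLp q.ofLp)) = Sum.elim p.ofLp q.ofLp :=
      congrArg (fun f : (Fin n ⊕ Fin n → 𝕜) →ₗ[𝕜] _ ↦ f (Sum.elim p.ofLp q.ofLp)) hG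
    refine Prod.ext ?_ ?_
    · ext i
      change G _ (Sum.inl i) = _
      rw [h3, h4]; rfl
    · ext i
      change G _ (Sum.inr i) = _
      rw [h3, h4]; rfl

end Reduction

/-! ### Generation on `L²` forces control of the incoming values -/

section IncomingControl

theorem HasACDeriv.of_hasDerivAt {a b : ℝ} {f f' : ℝ → ℝ}
    (h : ∀ x, HasDerivAt f (f' x) x) (hf' : Continuous f') : HasACDeriv a b f f' := by
  have hd : _root_.deriv f = f' := funext fun x ↦ (h x).deriv
  have hC : ContDiff ℝ 1 f := contDiff_one_iff_deriv.2
    ⟨fun x ↦ (h x).differentiableAt, by rwa [hd]⟩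
  exact ⟨hC.contDiffOn.absolutelyContinuousOnInterval, hf'.intervalIntegrable _ _,
    Eventually.of_forall fun x _ ↦ h x⟩

/-- Functions concentrated near the boundary point where a characteristic variable with speed
`s d` leaves, and almost eigenfunctions of the adjoint transport operator. -/
theorem exists_boundary_layer {a b : ℝ} (hab : a < b) {s : ℝ} (hs : s = 1 ∨ s = -1) {d : ℝ → ℝ}
    (hd : ContinuousOn d (Icc a b)) (hd0 : ∀ ξ ∈ Icc a b, 0 < d ξ) :
    ∃ (ε : ℝ → ℝ) (ψ ψ' : ℝ → ℝ → ℝ), Tendsto ε atTop (𝓝 0) ∧ ∀ l, 0 < l →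
      HasACDeriv a b (ψ l) (ψ' l) ∧ ψ l a = (1 + s) / 2 ∧ ψ l b = (1 - s) / 2 ∧
      ∀ ξ ∈ Icc a b, l * ψ l ξ + s * d ξ * ψ' l ξ = ε l := by
  set r : ℝ → ℝ := IccExtend hab.le ((Icc a b).domRestrict fun ξ ↦ (d ξ)⁻¹) with hr
  have hrc : Continuous r :=
    (hd.inv₀ fun ξ hξ ↦ (hd0 ξ hξ).ne').domRestrict.Icc_extend'
  have er : ∀ ξ ∈ Icc a b, r ξ = (d ξ)⁻¹ := fun ξ hξ ↦ IccExtend_of_mem hab.le _ hξ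
  set P : ℝ → ℝ := fun t ↦ ∫ ξ in a..t, r ξ with hP
  have hPd : ∀ t, HasDerivAt P (r t) t := fun t ↦
    intervalIntegral.integral_hasDerivAt_right (hrc.intervalIntegrable _ _)
      hrc.stronglyMeasurable.stronglyMeasurableAtFilter hrc.continuousAt
  have hPc : Continuous P := continuous_iff_continuousAt.2 fun t ↦ (hPd t).continuousAt
  set L := P b with hL
  have hPa : P a = 0 := by simp [hP]
  have hLpos : 0 < L := intervalIntegral.intervalIntegral_pos_of_pos_on
    (hrc.intervalIntegrable _ _) (fun ξ hξ ↦ by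
      rw [er ξ (Ioo_subset_Icc_self hξ)]
      exact inv_pos.2 (hd0 ξ (Ioo_subset_Icc_self hξ))) hab
  -- The travel time from `ξ` to the exit point: `P` if `s = 1`, `L - P` if `s = -1`. Since `s d τ'
  -- = 1` on `[a, b]`, `exp (-l τ)` solves `l ψ + s d ψ' = 0` exactly.
  set τ : ℝ → ℝ := fun ξ ↦ (1 - s) / 2 * L + s * P ξ with hτ
  have hτd : ∀ ξ, HasDerivAt τ (s * r ξ) ξ := fun ξ ↦ ((hPd ξ).const_mul s).const_add _
  have hτc : Continuous τ := by fun_prop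
  have hlt : ∀ l, 0 < l → Real.exp (-l * L) < 1 := fun l hl ↦ by
    rw [Real.exp_lt_one_iff]; nlinarith
  -- Subtracting `exp (-l L)` makes the layer vanish at the entry point and the denominator makes it
  -- `1` at the exit; the cost is the constant defect `ε l`.
  refine ⟨fun l ↦ -(l * Real.exp (-l * L) / (1 - Real.exp (-l * L))),
    fun l ξ ↦ (Real.exp (-l * τ ξ) - Real.exp (-l * L)) / (1 - Real.exp (-l * L)),
    fun l ξ ↦ Real.exp (-l * τ ξ) * (-l * (s * r ξ)) / (1 - Real.exp (-l * L)), ?_, ?_⟩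
  · have h1 : Tendsto (fun l : ℝ ↦ Real.exp (-l * L)) atTop (𝓝 0) := by
      simp only [neg_mul]
      exact Real.tendsto_exp_neg_atTop_nhds_zero.comp (tendsto_id.atTop_mul_const hLpos)
    have h2 : Tendsto (fun l : ℝ ↦ l * Real.exp (-l * L)) atTop (𝓝 0) := by
      have h3 := (Real.tendsto_pow_mul_exp_neg_atTop_nhds_zero 1).comp
        (tendsto_id.atTop_mul_const hLpos)
      have h4 := h3.const_mul L⁻¹
      rw [mul_zero] at h4
      refine h4.congr fun l ↦ ?_
      simp only [Function.comp, id, pow_one, neg_mul]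
      field_simp
    simpa using (h2.div (h1.const_sub 1) (by norm_num)).neg
  · intro l hl
    have hne : 1 - Real.exp (-l * L) ≠ 0 := (sub_pos.2 (hlt l hl)).ne'
    refine ⟨HasACDeriv.of_hasDerivAt (fun ξ ↦ ?_) (by fun_prop), ?_, ?_, fun ξ hξ ↦ ?_⟩
    · exact ((((hτd ξ).const_mul (-l)).exp).sub_const _).div_const _
    · rcases hs with rfl | rfl
      · simp only [hτ, hPa]
        rw [div_eq_iff hne]; norm_num
      · simp only [hτ, hPa]
        rw [div_eq_iff hne]; norm_num
    · rcases hs with rfl | rfl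
      · simp only [hτ, ← hL]
        rw [div_eq_iff hne]; norm_num
      · simp only [hτ, ← hL]
        rw [div_eq_iff hne]; norm_num
    · have hss : s * s = 1 := by rcases hs with rfl | rfl <;> norm_num
      have hdξ := (hd0 ξ hξ).ne'
      simp only [er ξ hξ]
      field_simp
      have : s ^ 2 = 1 := by rw [sq, hss]
      rw [this]; ring

variable {𝕜 : Type*} [RCLike 𝕜] {n : ℕ}

theorem charSign_eq_or (m : ℕ) (i : Fin n) : charSign m i = 1 ∨ charSign m i = -1 := by
  unfold charSign; split_ifs <;> simp

instance HBCS.isFiniteMeasure_measure (Sys : HBCS 𝕜 n) : IsFiniteMeasure Sys.measure := by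
  unfold HBCS.measure; infer_instance

theorem HBCS.integral_measure {E : Type*} [NormedAddCommGroup E] [NormedSpace ℝ E]
    (Sys : HBCS 𝕜 n) (f : ℝ → E) : ∫ ξ, f ξ ∂Sys.measure = ∫ ξ in Sys.a..Sys.b, f ξ := by
  rw [intervalIntegral.integral_of_le Sys.hab.le, HBCS.measure, integral_Icc_eq_integral_Ioc]

namespace HBCS.CharForm

variable {Sys : HBCS 𝕜 n} (cf : Sys.CharForm)

theorem S_memLp (i j : Fin n) : MemLp (fun ξ ↦ cf.S ξ i j) ⊤ Sys.measure :=
  (cf.S_cont i j).memLp_top_restrict_Icc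

theorem S_inv_memLp (i j : Fin n) : MemLp (fun ξ ↦ (cf.S ξ)⁻¹ i j) ⊤ Sys.measure :=
  (continuousOn_matrix_inv_apply cf.S_cont cf.S_unit i j).memLp_top_restrict_Icc

/-- The transformation to characteristic variables is invertible on `L^p`. -/
theorem exists_transform (p : ENNReal) [Fact (1 ≤ p)] :
    ∃ T J : Sys.StateSpace p →L[𝕜] Sys.StateSpace p,
      (∀ x, ∀ᵐ ξ ∂Sys.measure, T x ξ = matAct (cf.S ξ) (x ξ)) ∧ (∀ x, T (J x) = x) ∧
      ∀ x, J (T x) = x := by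
  obtain ⟨T, hT⟩ := exists_mulOp (μ := Sys.measure) p cf.S_memLp
  obtain ⟨J, hJ⟩ := exists_mulOp (μ := Sys.measure) p cf.S_inv_memLp
  refine ⟨T, J, hT, fun x ↦ Lp.ext ?_, fun x ↦ Lp.ext ?_⟩
  · filter_upwards [hT (J x), hJ x, ae_restrict_mem measurableSet_Icc] with ξ h1 h2 hξ
    rw [h1, h2, ← matAct_mul, Matrix.mul_nonsing_inv _
      ((Matrix.isUnit_iff_isUnit_det _).1 (cf.S_unit ξ hξ)), matAct_one]
  · filter_upwards [hJ (T x), hT x, ae_restrict_mem measurableSet_Icc] with ξ h1 h2 hξ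
    rw [h1, h2, ← matAct_mul, Matrix.nonsing_inv_mul _
      ((Matrix.isUnit_iff_isUnit_det _).1 (cf.S_unit ξ hξ)), matAct_one]

/-- If the incoming values are not controlled by the boundary input, some nontrivial combination
of the outgoing values vanishes on the domain of the generator. -/
theorem exists_outgoing_constraint (hW : Sys.WB.rank = n)
    (h : ¬ Function.Injective fun p ↦ cf.boundary Sys.WB (p, 0)) :
    ∃ β : Fin n → 𝕜, β ≠ 0 ∧ ∀ v : ℝ → KVec 𝕜 n, bdryAct Sys.WB (v Sys.b) (v Sys.a) = 0 →
      ∑ i, β i * cf.outgoing v i = 0 := by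
  set K : KVec 𝕜 n →ₗ[𝕜] KVec 𝕜 n := (cf.boundary Sys.WB).comp (LinearMap.inl 𝕜 _ _) with hK
  -- An endomorphism in finite dimension that is not injective is not surjective, so a nonzero
  -- functional `η` kills its range.
  have h1 : LinearMap.range K < ⊤ := by
    rw [lt_top_iff_ne_top]
    intro h2
    exact h (LinearMap.injective_iff_surjective.2 (LinearMap.range_eq_top.1 h2))
  obtain ⟨η, hη0, hη⟩ := Submodule.exists_le_ker_of_lt_top _ h1
  have hη1 : ∀ p, η (cf.boundary Sys.WB (p, 0)) = 0 := fun p ↦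
    hη (LinearMap.mem_range_self K p)
  have hsum : ∀ q : KVec 𝕜 n, η (cf.boundary Sys.WB (0, q)) =
      ∑ i, η (cf.boundary Sys.WB (0, EuclideanSpace.single i 1)) * q i := by
    intro q
    have : q = ∑ i, q i • EuclideanSpace.single i (1 : 𝕜) := by
      ext k
      simp [Finset.sum_apply, Pi.single_apply]
    set N : KVec 𝕜 n →ₗ[𝕜] 𝕜 := η.comp ((cf.boundary Sys.WB).comp (LinearMap.inr 𝕜 _ _))
    change N q = ∑ i, N (EuclideanSpace.single i 1) * q i
    conv_lhs => rw [this]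
    simp [mul_comm]
  have hsplit : ∀ p q, η (cf.boundary Sys.WB (p, q)) = η (cf.boundary Sys.WB (0, q)) := by
    intro p q
    have : ((p, q) : KVec 𝕜 n × KVec 𝕜 n) = (p, 0) + (0, q) := by simp
    rw [this, map_add, map_add, hη1, zero_add]
  -- If all these coefficients vanished, `η` would vanish on the range of the boundary map, which is
  -- everything because `WB` has full rank.
  refine ⟨fun i ↦ η (cf.boundary Sys.WB (0, EuclideanSpace.single i 1)), fun h0 ↦ hη0 ?_, ?_⟩
  · ext1 u
    obtain ⟨⟨p, q⟩, rfl⟩ := cf.boundary_surjective hW u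
    rw [hsplit, hsum]
    simp [fun i ↦ congrFun h0 i]
  · intro v hv
    rw [← hsum, ← hsplit (cf.incoming v), boundary_incoming_outgoing, hv, map_zero]

/-- Integration by parts against a boundary layer. -/
theorem integral_layer {p : ENNReal} [hp : Fact (1 ≤ p)] {x z : Sys.StateSpace p}
    {v : ℝ → KVec 𝕜 n} (h : Sys.MaxOperator p x z v) {T R : Sys.StateSpace p →L[𝕜] Sys.StateSpace p}
    (hT : ∀ x, ∀ᵐ ξ ∂Sys.measure, T x ξ = matAct (cf.S ξ) (x ξ))
    (hR : ∀ x, ∀ᵐ ξ ∂Sys.measure, R x ξ = matAct (cf.R ξ) (x ξ)) (i : Fin n) {ψ ψ' : ℝ → ℝ}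
    (hψ : HasACDeriv Sys.a Sys.b ψ ψ') (hψa : ψ Sys.a = (1 + charSign cf.m i) / 2)
    (hψb : ψ Sys.b = (1 - charSign cf.m i) / 2) {l ε : ℝ}
    (hε : ∀ ξ ∈ Icc Sys.a Sys.b, l * ψ ξ + charSign cf.m i * cf.d i ξ * ψ' ξ = ε) :
    ∫ ξ, (ψ ξ : 𝕜) * T z ξ i ∂Sys.measure = -((charSign cf.m i : ℝ) : 𝕜) * cf.outgoing v i +
      l * ∫ ξ, (ψ ξ : 𝕜) * T x ξ i ∂Sys.measure - ε * ∫ ξ, (1 : 𝕜) * T x ξ i ∂Sys.measure +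
      ∫ ξ, (ψ ξ : 𝕜) * R x ξ i ∂Sys.measure := by
  obtain ⟨w', hw, hw1, hw2⟩ := cf.char p x z v h i
  set w : ℝ → 𝕜 := fun ξ ↦ matAct (cf.S ξ * Sys.P₁) (v ξ) i with hwdef
  have hψ1 := hψ.clm_comp (RCLike.ofRealCLM (K := 𝕜))
  simp only [RCLike.ofRealCLM_apply] at hψ1
  have hibp := (hψ1.mul hw).eq_integral Sys.hab.le
  rw [← Sys.integral_measure] at hibp
  have hψm : MemLp (fun ξ ↦ (ψ ξ : 𝕜)) ⊤ Sys.measure :=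
    ContinuousOn.memLp_top_restrict_Icc (by
      have := hψ1.ac.continuousOn; rwa [uIcc_of_le Sys.hab.le] at this)
  have h1m : MemLp (fun _ : ℝ ↦ (1 : 𝕜)) ⊤ Sys.measure :=
    continuousOn_const.memLp_top_restrict_Icc
  have i1 := integrable_mul_Lp hψm (T x) i
  have i2 := integrable_mul_Lp h1m (T x) i
  have i3 := integrable_mul_Lp hψm (R x) i
  -- Since `w = s d (T x)`, the layer equation gives `ψ' w = (ε - l ψ) T x`; the rest of `ψ w'` is
  -- the total derivative of `ψ w`.
  have hae : ∀ᵐ ξ ∂Sys.measure, (ψ ξ : 𝕜) * T z ξ i =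
      ((ψ' ξ : 𝕜) * w ξ + (ψ ξ : 𝕜) * w' ξ) + (l : 𝕜) * ((ψ ξ : 𝕜) * T x ξ i) -
        (ε : 𝕜) * ((1 : 𝕜) * T x ξ i) + (ψ ξ : 𝕜) * R x ξ i := by
    filter_upwards [hT x, hT z, hR x, hw1, hw2, ae_restrict_mem measurableSet_Icc] with
      ξ e1 e2 e3 e4 e5 hξ
    have e6 := hε ξ hξ
    rw [e2, e5, ← e3]
    simp only [hwdef]
    rw [e4, ← e1, ← e6]
    push_cast
    ring
  rw [integral_congr_ae hae]
  have i5 : Integrable (fun ξ ↦ (ψ' ξ : 𝕜) * w ξ + (ψ ξ : 𝕜) * w' ξ) Sys.measure := by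
    have := (hψ1.mul hw).int
    rwa [intervalIntegrable_iff_integrableOn_Icc_of_le Sys.hab.le] at this
  have i6 : Integrable (fun ξ ↦ ((ψ' ξ : 𝕜) * w ξ + (ψ ξ : 𝕜) * w' ξ) +
      (l : 𝕜) * ((ψ ξ : 𝕜) * T x ξ i)) Sys.measure := i5.add (i1.const_mul _)
  have i7 : Integrable (fun ξ ↦ ((ψ' ξ : 𝕜) * w ξ + (ψ ξ : 𝕜) * w' ξ) +
      (l : 𝕜) * ((ψ ξ : 𝕜) * T x ξ i) - (ε : 𝕜) * ((1 : 𝕜) * T x ξ i)) Sys.measure :=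
    i6.sub (i2.const_mul _)
  rw [integral_add i7 i3, integral_sub i6 (i2.const_mul _), integral_add i5 (i1.const_mul _),
    integral_const_mul, integral_const_mul, hibp]
  congr 3
  rw [hψa, hψb]
  simp only [outgoing, mixVec_apply, charSign, hwdef]
  split_ifs <;> norm_num

/-- Generation of a strongly continuous semigroup on `L²` forces the boundary input to determine
the incoming values, given the outgoing ones. -/
theorem injective_of_generates (hSys : Sys.StandingAssumptions) :
    Function.Injective fun p ↦ cf.boundary Sys.WB (p, 0) := by
  by_contra hcon
  obtain ⟨β, hβ, hout⟩ := cf.exists_outgoing_constraint hSys.WB_fullRank hcon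
  obtain ⟨i₀, hi₀⟩ := Function.ne_iff.1 hβ
  obtain ⟨T, J, hT, hTJ, -⟩ := cf.exists_transform 2
  obtain ⟨R, hR⟩ := exists_mulOp (μ := Sys.measure) 2 cf.R_bounded
  obtain ⟨C, hC⟩ := hSys.generates.exists_functional_bound (J.comp R)
  choose ε ψ ψ' hε hψ using fun i ↦ exists_boundary_layer Sys.hab (charSign_eq_or cf.m i)
    (cf.d_cont i) (cf.d_pos i)
  -- The sign compensates the one produced by integration by parts, so that the boundary terms sum
  -- to the vanishing combination with coefficients `β`.
  set c : Fin n → 𝕜 := fun i ↦ -((charSign cf.m i : ℝ) : 𝕜) * β i with hc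
  have h1m : MemLp (fun _ : ℝ ↦ (1 : 𝕜)) ⊤ Sys.measure :=
    continuousOn_const.memLp_top_restrict_Icc
  have hΞ : ∀ i, ∃ Ξ : Sys.StateSpace 2 →L[𝕜] 𝕜, ∀ x, Ξ x = ∫ ξ, (1 : 𝕜) * x ξ i ∂Sys.measure := by
    intro i
    obtain ⟨Ξ, h⟩ := exists_pairing (n := n) (μ := Sys.measure) 2
      (θ := fun j _ ↦ if j = i then (1 : 𝕜) else 0)
      (fun j ↦ continuousOn_const.memLp_top_restrict_Icc)
    refine ⟨Ξ, fun x ↦ ?_⟩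
    rw [h, Finset.sum_eq_single i]
    · simp
    · intro j _ hj; simp [hj]
    · simp
  choose Ξ hΞ using hΞ
  have hψm : ∀ l, 0 < l → ∀ i, MemLp (fun ξ ↦ c i * (ψ i l ξ : 𝕜)) ⊤ Sys.measure := by
    intro l hl i
    refine ContinuousOn.memLp_top_restrict_Icc (continuousOn_const.mul ?_)
    have := (hψ i l hl).1.ac.continuousOn
    rw [uIcc_of_le Sys.hab.le] at this
    exact RCLike.continuous_ofReal.comp_continuousOn this
  set E : ℝ → Sys.StateSpace 2 →L[𝕜] 𝕜 := fun l ↦ ∑ i, (c i * (ε i l : 𝕜)) • (Ξ i).comp T with hE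
  have hElim : Tendsto E atTop (𝓝 0) := by
    have : Tendsto E atTop (𝓝 (∑ i, (c i * ((0 : ℝ) : 𝕜)) • (Ξ i).comp T)) := by
      refine tendsto_finsetSum _ fun i _ ↦ Tendsto.smul_const (Tendsto.const_mul _ ?_) _
      exact (RCLike.continuous_ofReal.tendsto 0).comp (hε i)
    rwa [Finset.sum_eq_zero fun i _ ↦ by rw [RCLike.ofReal_zero, mul_zero]; exact zero_smul 𝕜 ((Ξ i).comp T)]
      at this
  -- a state whose transform is concentrated in one component
  have hdinv : ContinuousOn (fun ξ ↦ (((cf.d i₀ ξ)⁻¹ : ℝ) : 𝕜)) (Icc Sys.a Sys.b) :=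
    RCLike.continuous_ofReal.comp_continuousOn
      ((cf.d_cont i₀).inv₀ fun ξ hξ ↦ (cf.d_pos i₀ ξ hξ).ne')
  have hx₀m : MemLp (fun ξ ↦ (EuclideanSpace.single i₀ (((cf.d i₀ ξ)⁻¹ : ℝ) : 𝕜) : KVec 𝕜 n)) 2
      Sys.measure := by
    refine MemLp.mono_exponent (q := ⊤) (ContinuousOn.memLp_top_restrict_Icc ?_) le_top
    have : Continuous fun t : 𝕜 ↦ (EuclideanSpace.single i₀ t : KVec 𝕜 n) := by
      have h2 : (fun t : 𝕜 ↦ (EuclideanSpace.single i₀ t : KVec 𝕜 n)) =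
          fun t ↦ t • EuclideanSpace.single i₀ (1 : 𝕜) := by
        ext t k; simp
      rw [h2]; fun_prop
    exact this.comp_continuousOn hdinv
  set x₀ : Sys.StateSpace 2 := J (hx₀m.toLp _) with hx₀
  have hkey : ∀ᶠ l : ℝ in atTop,
      ‖c i₀ * ((1 + ε i₀ l * ∫ ξ in Sys.a..Sys.b, (cf.d i₀ ξ)⁻¹ : ℝ) : 𝕜)‖ ≤
        C * ‖E l‖ * ‖x₀‖ := by
    filter_upwards [hC, eventually_gt_atTop 0] with l hl hl0
    obtain ⟨Φ₀, hΦ₀⟩ := exists_pairing (n := n) (μ := Sys.measure) 2 (hψm l hl0)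
    have hΦ : ∀ x, Φ₀.comp T x = ∑ i, c i * ∫ ξ, (ψ i l ξ : 𝕜) * T x ξ i ∂Sys.measure := by
      intro x
      rw [ContinuousLinearMap.comp_apply, hΦ₀]
      refine Finset.sum_congr rfl fun i _ ↦ ?_
      rw [← integral_const_mul]
      simp only [mul_assoc]
    have hbound := hl (Φ₀.comp T) (E l) (by
      rintro x z ⟨v, hmax, hv⟩
      rw [hΦ, hΦ, hΦ]
      have hEx : E l x = ∑ i, c i * ((ε i l : 𝕜) * ∫ ξ, (1 : 𝕜) * T x ξ i ∂Sys.measure) := by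
        simp only [hE, sum_apply, smul_apply, ContinuousLinearMap.comp_apply, hΞ, smul_eq_mul,
          mul_assoc]
      have hJR : T ((J.comp R) x) = R x := hTJ (R x)
      have hb0 : ∑ i, c i * (-((charSign cf.m i : ℝ) : 𝕜) * cf.outgoing v i) = 0 := by
        rw [← hout v hv]
        refine Finset.sum_congr rfl fun i _ ↦ ?_
        have : ((charSign cf.m i : ℝ) : 𝕜) * ((charSign cf.m i : ℝ) : 𝕜) = 1 := by
          rcases charSign_eq_or cf.m i with h | h <;> rw [h] <;> norm_num
        simp only [hc]
        linear_combination (β i * cf.outgoing v i) * this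
      rw [hEx, hJR, Finset.mul_sum, ← zero_add (∑ i, (l : 𝕜) * _), ← hb0,
        ← Finset.sum_add_distrib, ← Finset.sum_sub_distrib, ← Finset.sum_add_distrib]
      refine Finset.sum_congr rfl fun i _ ↦ ?_
      obtain ⟨h1, h2, h3, h4⟩ := hψ i l hl0
      rw [cf.integral_layer hmax hT hR i h1 h2 h3 h4]
      ring)
    have hval : (l : 𝕜) * Φ₀.comp T x₀ =
        c i₀ * ((1 + ε i₀ l * ∫ ξ in Sys.a..Sys.b, (cf.d i₀ ξ)⁻¹ : ℝ) : 𝕜) := by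
      have hTx : T x₀ =ᵐ[Sys.measure] fun ξ ↦ EuclideanSpace.single i₀ (((cf.d i₀ ξ)⁻¹ : ℝ) : 𝕜) := by
        rw [hx₀, hTJ]; exact hx₀m.coeFn_toLp
      rw [hΦ, Finset.sum_eq_single i₀]
      · obtain ⟨h1, h2, h3, h4⟩ := hψ i₀ l hl0
        have e1 : ∫ ξ, (ψ i₀ l ξ : 𝕜) * T x₀ ξ i₀ ∂Sys.measure =
            ((∫ ξ in Sys.a..Sys.b, ψ i₀ l ξ * (cf.d i₀ ξ)⁻¹ : ℝ) : 𝕜) := by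
          rw [← Sys.integral_measure, ← integral_ofReal]
          refine integral_congr_ae ?_
          filter_upwards [hTx] with ξ hξ
          rw [hξ]; simp
        have hdi : IntervalIntegrable (fun ξ ↦ (cf.d i₀ ξ)⁻¹) volume Sys.a Sys.b := by
          apply ContinuousOn.intervalIntegrable
          rw [uIcc_of_le Sys.hab.le]
          exact (cf.d_cont i₀).inv₀ fun ξ hξ ↦ (cf.d_pos i₀ ξ hξ).ne'
        -- Dividing the layer equation by `d` leaves the exact derivative `s ψ'`, and `s (ψ a - ψ b)
        -- = 1`. This is why `x₀` carries the factor `d⁻¹`: `l Φ x₀` is then computed exactly and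
        -- does not decay.
        have e2 : l * ∫ ξ in Sys.a..Sys.b, ψ i₀ l ξ * (cf.d i₀ ξ)⁻¹ =
            1 + ε i₀ l * ∫ ξ in Sys.a..Sys.b, (cf.d i₀ ξ)⁻¹ := by
          have e3 : ∫ ξ in Sys.a..Sys.b, l * (ψ i₀ l ξ * (cf.d i₀ ξ)⁻¹) =
              ∫ ξ in Sys.a..Sys.b, (ε i₀ l * (cf.d i₀ ξ)⁻¹ - charSign cf.m i₀ * ψ' i₀ l ξ) := by
            refine intervalIntegral.integral_congr fun ξ hξ ↦ ?_
            rw [uIcc_of_le Sys.hab.le] at hξ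
            have hd := (cf.d_pos i₀ ξ hξ).ne'
            simp only [← h4 ξ hξ]
            field_simp
            ring
          rw [← intervalIntegral.integral_const_mul, e3,
            intervalIntegral.integral_sub (hdi.const_mul _) (h1.int.const_mul _),
            intervalIntegral.integral_const_mul, intervalIntegral.integral_const_mul,
            h1.eq_integral Sys.hab.le, h2, h3]
          rcases charSign_eq_or cf.m i₀ with h | h <;> rw [h] <;> ring
        rw [e1, ← e2]
        push_cast
        ring
      · intro j _ hj
        have : ∫ ξ, (ψ j l ξ : 𝕜) * T x₀ ξ j ∂Sys.measure = ∫ ξ, (0 : 𝕜) ∂Sys.measure := by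
          refine integral_congr_ae ?_
          filter_upwards [hTx] with ξ hξ
          rw [hξ]; simp [hj]
        rw [this]; simp
      · simp
    rw [← hval, norm_mul, RCLike.norm_ofReal, abs_of_pos hl0]
    calc l * ‖Φ₀.comp T x₀‖ ≤ l * (‖Φ₀.comp T‖ * ‖x₀‖) := by
          gcongr; exact ContinuousLinearMap.le_opNorm _ _
      _ = l * ‖Φ₀.comp T‖ * ‖x₀‖ := by ring
      _ ≤ C * ‖E l‖ * ‖x₀‖ := by gcongr
  have hL : Tendsto (fun l ↦ ‖c i₀ * ((1 + ε i₀ l * ∫ ξ in Sys.a..Sys.b, (cf.d i₀ ξ)⁻¹ : ℝ) : 𝕜)‖)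
      atTop (𝓝 ‖c i₀‖) := by
    have h1 : Tendsto (fun l ↦ 1 + ε i₀ l * ∫ ξ in Sys.a..Sys.b, (cf.d i₀ ξ)⁻¹) atTop (𝓝 1) := by
      simpa using ((hε i₀).mul_const (∫ ξ in Sys.a..Sys.b, (cf.d i₀ ξ)⁻¹)).const_add 1
    have h2 := (((RCLike.continuous_ofReal (K := 𝕜)).tendsto 1).comp h1).const_mul (c i₀)
    simpa using h2.norm
  have hRlim : Tendsto (fun l ↦ C * ‖E l‖ * ‖x₀‖) atTop (𝓝 0) := by
    simpa using (hElim.norm.const_mul C).mul_const ‖x₀‖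
  have h0 : ‖c i₀‖ ≤ 0 := le_of_tendsto_of_tendsto hL hRlim hkey
  have h1 : c i₀ = 0 := norm_le_zero_iff.1 h0
  simp only [hc] at h1
  rcases charSign_eq_or cf.m i₀ with h | h <;> rw [h] at h1 <;> exact hi₀ (by simpa using h1)

end HBCS.CharForm

end IncomingControl

/-! ### Weighted `L¹` norms and dissipation -/

section Lyapunov

variable {𝕜 : Type*} [RCLike 𝕜] {n : ℕ}

theorem kvec_norm_le_sum (q : KVec 𝕜 n) : ‖q‖ ≤ ∑ i, ‖q i‖ := by
  have : q = ∑ i, EuclideanSpace.single i (q i) := by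
    ext k
    simp [Finset.sum_apply, Pi.single_apply]
  conv_lhs => rw [this]
  refine (norm_sum_le _ _).trans_eq ?_
  simp

theorem kvec_sum_le_norm (q : KVec 𝕜 n) : ∑ i, ‖q i‖ ≤ n * ‖q‖ := by
  calc ∑ i, ‖q i‖ ≤ ∑ _i : Fin n, ‖q‖ := Finset.sum_le_sum fun i _ ↦ PiLp.norm_apply_le q i
    _ = n * ‖q‖ := by simp

theorem LinearMap.exists_kvec_bound (M : KVec 𝕜 n × KVec 𝕜 n →ₗ[𝕜] KVec 𝕜 n) :
    ∃ c : ℝ, 0 ≤ c ∧ ∀ p q, ∑ i, ‖M (p, q) i‖ ≤ c * (‖p‖ + ∑ i, ‖q i‖) := by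
  set L := LinearMap.toContinuousLinearMap M
  refine ⟨n * ‖L‖, by positivity, fun p q ↦ ?_⟩
  have h1 : ‖((p, q) : KVec 𝕜 n × KVec 𝕜 n)‖ ≤ ‖p‖ + ∑ i, ‖q i‖ := by
    rw [Prod.norm_def]
    refine max_le ?_ ?_
    · linarith [Finset.sum_nonneg fun i (_ : i ∈ Finset.univ) ↦ norm_nonneg (q i)]
    · linarith [kvec_norm_le_sum q, norm_nonneg p]
  calc ∑ i, ‖M (p, q) i‖ ≤ n * ‖L (p, q)‖ := kvec_sum_le_norm _
    _ ≤ n * (‖L‖ * (‖p‖ + ∑ i, ‖q i‖)) := by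
        gcongr
        exact (L.le_opNorm _).trans (by gcongr)
    _ = _ := by ring

/-- The weighted `L¹` norm of a vector function. -/
def weightedNorm (μ : Measure ℝ) (ρ : Fin n → ℝ → ℝ) (X : ℝ → KVec 𝕜 n) : ℝ :=
  ∑ i, ∫ ξ, ρ i ξ * ‖X ξ i‖ ∂μ

section Weights

variable {μ : Measure ℝ} [IsFiniteMeasure μ] {ρ : Fin n → ℝ → ℝ} {r : ℝ}

theorem integrable_weight (hρ : ∀ i, AEStronglyMeasurable (ρ i) μ)
    (hρr : ∀ i, ∀ᵐ ξ ∂μ, 1 ≤ ρ i ξ ∧ ρ i ξ ≤ r) (X : Lp (KVec 𝕜 n) 1 μ) (i : Fin n) :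
    Integrable (fun ξ ↦ ρ i ξ * ‖X ξ i‖) μ := by
  refine Integrable.bdd_mul (c := r) ?_ (hρ i) ?_
  · have := integrable_mul_Lp (θ := fun _ ↦ (1 : 𝕜)) (memLp_const 1) X i
    simpa using this.norm
  · filter_upwards [hρr i] with ξ hξ
    rw [Real.norm_eq_abs, abs_of_nonneg (by linarith)]
    exact hξ.2

theorem norm_le_weightedNorm (hρ : ∀ i, AEStronglyMeasurable (ρ i) μ)
    (hρr : ∀ i, ∀ᵐ ξ ∂μ, 1 ≤ ρ i ξ ∧ ρ i ξ ≤ r) (X : Lp (KVec 𝕜 n) 1 μ) :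
    ‖X‖ ≤ weightedNorm μ ρ X := by
  have hi := integrable_weight hρ hρr X
  rw [L1.norm_eq_integral_norm, weightedNorm, ← integral_finsetSum _ fun i _ ↦ hi i]
  refine integral_mono_ae (L1.integrable_coeFn X).norm (integrable_finsetSum _ fun i _ ↦ hi i) ?_
  filter_upwards [ae_all_iff.2 hρr] with ξ hξ
  refine (kvec_norm_le_sum _).trans (Finset.sum_le_sum fun i _ ↦ ?_)
  nlinarith [hξ i, norm_nonneg (X ξ i)]

theorem weightedNorm_le (hρ : ∀ i, AEStronglyMeasurable (ρ i) μ)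
    (hρr : ∀ i, ∀ᵐ ξ ∂μ, 1 ≤ ρ i ξ ∧ ρ i ξ ≤ r) (X : Lp (KVec 𝕜 n) 1 μ) :
    weightedNorm μ ρ X ≤ n * r * ‖X‖ := by
  have hi := integrable_weight hρ hρr X
  calc weightedNorm μ ρ X ≤ ∑ _i : Fin n, r * ‖X‖ := by
        refine Finset.sum_le_sum fun i _ ↦ ?_
        rw [L1.norm_eq_integral_norm, ← integral_const_mul]
        refine integral_mono_ae (hi i) ((L1.integrable_coeFn X).norm.const_mul r) ?_
        filter_upwards [hρr i] with ξ hξ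
        exact mul_le_mul hξ.2 (PiLp.norm_apply_le _ _) (norm_nonneg _) (by linarith)
    _ = n * r * ‖X‖ := by simp; ring

theorem weightedNorm_le_add (hρ : ∀ i, AEStronglyMeasurable (ρ i) μ)
    (hρr : ∀ i, ∀ᵐ ξ ∂μ, 1 ≤ ρ i ξ ∧ ρ i ξ ≤ r) (X Y : Lp (KVec 𝕜 n) 1 μ) :
    weightedNorm μ ρ X ≤ weightedNorm μ ρ Y + weightedNorm μ ρ (X - Y : Lp (KVec 𝕜 n) 1 μ) := by
  rw [weightedNorm, weightedNorm, weightedNorm, ← Finset.sum_add_distrib]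
  refine Finset.sum_le_sum fun i _ ↦ ?_
  have h1 := integrable_weight hρ hρr Y i
  have h2 := integrable_weight hρ hρr (X - Y) i
  rw [← integral_add h1 h2]
  refine integral_mono_ae (integrable_weight hρ hρr X i) (h1.add h2) ?_
  filter_upwards [hρr i, Lp.coeFn_sub X Y] with ξ hξ h3
  rw [h3, ← mul_add]
  refine mul_le_mul_of_nonneg_left ?_ (by linarith)
  have := norm_add_le (Y ξ i) (X ξ i - Y ξ i)
  rwa [add_sub_cancel] at this

theorem continuous_weightedNorm (hρ : ∀ i, AEStronglyMeasurable (ρ i) μ)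
    (hρr : ∀ i, ∀ᵐ ξ ∂μ, 1 ≤ ρ i ξ ∧ ρ i ξ ≤ r) (hr : 0 ≤ r) :
    Continuous fun X : Lp (KVec 𝕜 n) 1 μ ↦ weightedNorm μ ρ X := by
  refine (LipschitzWith.of_le_add_mul (n * r).toNNReal fun X Y ↦ ?_).continuous
  rw [Real.coe_toNNReal _ (by positivity), dist_eq_norm]
  exact (weightedNorm_le_add hρ hρr X Y).trans (by gcongr; exact weightedNorm_le hρ hρr _)

/-- A norming functional for the weighted `L¹` norm. -/
theorem exists_norming (hρ : ∀ i, AEStronglyMeasurable (ρ i) μ)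
    (hρr : ∀ i, ∀ᵐ ξ ∂μ, 1 ≤ ρ i ξ ∧ ρ i ξ ≤ r) (X : Lp (KVec 𝕜 n) 1 μ) :
    ∃ L : Lp (KVec 𝕜 n) 1 μ →L[ℝ] ℝ, (∀ Y, L Y ≤ weightedNorm μ ρ Y) ∧
      L X = weightedNorm μ ρ X ∧
      ∀ Y, (∀ i, Integrable (fun ξ ↦ RCLike.re ((starRingEnd 𝕜)
        (((‖X ξ i‖⁻¹ : ℝ) : 𝕜) * X ξ i) * Y ξ i) * ρ i ξ) μ) ∧
      L Y = ∑ i, ∫ ξ, RCLike.re ((starRingEnd 𝕜)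
        (((‖X ξ i‖⁻¹ : ℝ) : 𝕜) * X ξ i) * Y ξ i) * ρ i ξ ∂μ := by
  have hsgn : ∀ z : 𝕜, ‖(starRingEnd 𝕜) (((‖z‖⁻¹ : ℝ) : 𝕜) * z)‖ ≤ 1 := fun z ↦ by
    rw [RCLike.norm_conj, norm_mul, RCLike.norm_ofReal, abs_inv, abs_norm]
    exact inv_mul_le_one
  -- The weight times the conjugate phase of `X`, with phase `0` where `X` vanishes because `0⁻¹ =
  -- 0`. The functional is the real part of the pairing with `θ`.
  set θ : Fin n → ℝ → 𝕜 := fun i ξ ↦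
    (ρ i ξ : 𝕜) * (starRingEnd 𝕜) (((‖X ξ i‖⁻¹ : ℝ) : 𝕜) * X ξ i) with hθ
  have hθm : ∀ i, MemLp (θ i) ⊤ μ := by
    intro i
    have hX := (Lp.aestronglyMeasurable X).kvec_apply i
    refine memLp_top_of_bound ?_ r ?_
    · refine (RCLike.continuous_ofReal.comp_aestronglyMeasurable (hρ i)).mul ?_
      refine RCLike.continuous_conj.comp_aestronglyMeasurable (AEStronglyMeasurable.mul ?_ hX)
      exact RCLike.continuous_ofReal.comp_aestronglyMeasurable
        hX.norm.aemeasurable.inv.aestronglyMeasurable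
    · filter_upwards [hρr i] with ξ hξ
      rw [hθ, norm_mul, RCLike.norm_ofReal, abs_of_nonneg (by linarith)]
      calc ρ i ξ * _ ≤ ρ i ξ * 1 := by gcongr; · linarith
                                       · exact hsgn _
        _ ≤ r := by linarith
  obtain ⟨P, hP⟩ := exists_pairing 1 hθm
  have hint : ∀ (Y : Lp (KVec 𝕜 n) 1 μ) i, Integrable (fun ξ ↦ RCLike.re ((starRingEnd 𝕜)
        (((‖X ξ i‖⁻¹ : ℝ) : 𝕜) * X ξ i) * Y ξ i) * ρ i ξ) μ := by
    intro Y i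
    refine (integrable_mul_Lp (hθm i) Y i).re.congr (Eventually.of_forall fun ξ ↦ ?_)
    simp only [hθ]
    rw [mul_assoc, RCLike.re_ofReal_mul, mul_comm]
  have hL : ∀ Y, RCLike.re (P Y) = ∑ i, ∫ ξ, RCLike.re ((starRingEnd 𝕜)
        (((‖X ξ i‖⁻¹ : ℝ) : 𝕜) * X ξ i) * Y ξ i) * ρ i ξ ∂μ := by
    intro Y
    rw [hP, map_sum]
    refine Finset.sum_congr rfl fun i _ ↦ ?_
    rw [← integral_re (integrable_mul_Lp (hθm i) Y i)]
    refine integral_congr_ae (Eventually.of_forall fun ξ ↦ ?_)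
    simp only [hθ]
    rw [mul_assoc, RCLike.re_ofReal_mul, mul_comm]
  refine ⟨RCLike.reCLM.comp (P.restrictScalars ℝ), fun Y ↦ ?_, ?_, fun Y ↦ ⟨hint Y, hL Y⟩⟩
  · refine (hL Y).trans_le (Finset.sum_le_sum fun i _ ↦ ?_)
    refine integral_mono_ae (hint Y i) (integrable_weight hρ hρr Y i) ?_
    filter_upwards [hρr i] with ξ hξ
    rw [mul_comm]
    refine mul_le_mul_of_nonneg_left ((RCLike.re_le_norm _).trans ?_) (by linarith)
    rw [norm_mul]
    exact mul_le_of_le_one_left (norm_nonneg _) (hsgn _)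
  · refine (hL X).trans (Finset.sum_congr rfl fun i _ ↦ ?_)
    refine integral_congr_ae (Eventually.of_forall fun ξ ↦ ?_)
    simp only []
    rw [map_mul (starRingEnd 𝕜), RCLike.conj_ofReal, mul_assoc, RCLike.re_ofReal_mul,
      RCLike.conj_mul, ← RCLike.ofReal_pow, RCLike.ofReal_re]
    rcases eq_or_ne ‖X ξ i‖ 0 with h | h
    · rw [h]; simp
    · field_simp

end Weights

namespace HBCS.CharForm

variable {Sys : HBCS 𝕜 n} (cf : Sys.CharForm)

/-- An affine weight with value `1` where the characteristic enters and `r` where it leaves. -/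
def weight (r : ℝ) (i : Fin n) (ξ : ℝ) : ℝ :=
  (r + 1) / 2 + charSign cf.m i * ((r - 1) / 2 * ((Sys.a + Sys.b - 2 * ξ) / (Sys.b - Sys.a)))

theorem weight_bounds {r : ℝ} (hr : 1 ≤ r) (i : Fin n) :
    ∀ᵐ ξ ∂Sys.measure, 1 ≤ cf.weight r i ξ ∧ cf.weight r i ξ ≤ r := by
  filter_upwards [ae_restrict_mem measurableSet_Icc] with ξ hξ
  have hab := sub_pos.2 Sys.hab
  have h1 : (Sys.a + Sys.b - 2 * ξ) / (Sys.b - Sys.a) ≤ 1 := by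
    rw [div_le_one hab]; linarith [hξ.1]
  have h2 : -1 ≤ (Sys.a + Sys.b - 2 * ξ) / (Sys.b - Sys.a) := by
    rw [le_div_iff₀ hab]; linarith [hξ.2]
  unfold weight
  set q := (Sys.a + Sys.b - 2 * ξ) / (Sys.b - Sys.a)
  rcases charSign_eq_or cf.m i with h | h <;> rw [h] <;> constructor <;> nlinarith

theorem continuous_weight (r : ℝ) (i : Fin n) : Continuous (cf.weight r i) := by
  unfold weight; fun_prop

theorem hasACDeriv_weight (r : ℝ) (i : Fin n) : HasACDeriv Sys.a Sys.b (cf.weight r i)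
    (fun _ ↦ -(charSign cf.m i * ((r - 1) / (Sys.b - Sys.a)))) := by
  refine HasACDeriv.of_hasDerivAt (fun ξ ↦ ?_) continuous_const
  have h1 : HasDerivAt (fun ξ : ℝ ↦ Sys.a + Sys.b - 2 * ξ) (-(2 * 1)) ξ :=
    ((hasDerivAt_id ξ).const_mul 2).const_sub _
  refine ((((h1.div_const (Sys.b - Sys.a)).const_mul ((r - 1) / 2)).const_mul
    (charSign cf.m i)).const_add ((r + 1) / 2)).congr_deriv ?_
  ring

theorem weight_a (r : ℝ) (i : Fin n) :
    cf.weight r i Sys.a = (r + 1) / 2 + charSign cf.m i * ((r - 1) / 2) := by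
  have hab := (sub_pos.2 Sys.hab).ne'
  rw [weight, show Sys.a + Sys.b - 2 * Sys.a = Sys.b - Sys.a by ring, div_self hab, mul_one]

theorem weight_b (r : ℝ) (i : Fin n) :
    cf.weight r i Sys.b = (r + 1) / 2 - charSign cf.m i * ((r - 1) / 2) := by
  have hab := (sub_pos.2 Sys.hab).ne'
  rw [weight, show Sys.a + Sys.b - 2 * Sys.b = -(Sys.b - Sys.a) by ring, neg_div, div_self hab]
  ring

/-- The dissipation estimate in the weighted `L¹` norm. -/
theorem exists_dissipation {r : ℝ} (hr : 1 ≤ r)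
    {T J : Sys.StateSpace 1 →L[𝕜] Sys.StateSpace 1}
    (hT : ∀ x, ∀ᵐ ξ ∂Sys.measure, T x ξ = matAct (cf.S ξ) (x ξ)) (hJT : ∀ x, J (T x) = x) :
    ∃ C : ℝ, 0 ≤ C ∧ ∀ (x z : Sys.StateSpace 1) (v : ℝ → KVec 𝕜 n), Sys.MaxOperator 1 x z v →
      ∃ L : Sys.StateSpace 1 →L[ℝ] ℝ, (∀ Y, L Y ≤ weightedNorm Sys.measure (cf.weight r) Y) ∧
        L (T x) = weightedNorm Sys.measure (cf.weight r) (T x) ∧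
        L (T z) ≤ ∑ i, ‖cf.incoming v i‖ - r * ∑ i, ‖cf.outgoing v i‖ +
          C * weightedNorm Sys.measure (cf.weight r) (T x) := by
  obtain ⟨R, hR⟩ := exists_mulOp (μ := Sys.measure) 1 cf.R_bounded
  choose D hD using fun i ↦ isCompact_Icc.exists_bound_of_continuousOn (cf.d_cont i)
  have hab := sub_pos.2 Sys.hab
  set κ : ℝ := (r - 1) / (Sys.b - Sys.a) with hκ
  have hκ0 : 0 ≤ κ := div_nonneg (by linarith) hab.le
  have hρ : ∀ i, AEStronglyMeasurable (cf.weight r i) Sys.measure := fun i ↦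
    (cf.continuous_weight r i).aestronglyMeasurable
  have hρr := fun i ↦ cf.weight_bounds hr i
  set D' : ℝ := ∑ i, |D i| with hD'
  have hD0 : 0 ≤ D' := Finset.sum_nonneg fun i _ ↦ abs_nonneg _
  -- The first summand pays for the slope of the weights, the second for the zero-order term, using
  -- `x = J (T x)`.
  refine ⟨κ * D' + n * r * (‖R‖ * ‖J‖), by positivity, fun x z v h ↦ ?_⟩
  obtain ⟨L, hL1, hL2, hL3⟩ := exists_norming hρ hρr (T x)
  refine ⟨L, hL1, hL2, ?_⟩
  have hterm : ∀ i, ∫ ξ, RCLike.re ((starRingEnd 𝕜)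
        (((‖T x ξ i‖⁻¹ : ℝ) : 𝕜) * T x ξ i) * T z ξ i) * cf.weight r i ξ ∂Sys.measure ≤
      ‖cf.incoming v i‖ - r * ‖cf.outgoing v i‖ +
      κ * D' * (∫ ξ, cf.weight r i ξ * ‖T x ξ i‖ ∂Sys.measure) +
      ∫ ξ, RCLike.re ((starRingEnd 𝕜)
        (((‖T x ξ i‖⁻¹ : ℝ) : 𝕜) * T x ξ i) * R x ξ i) * cf.weight r i ξ ∂Sys.measure := by
    intro i
    obtain ⟨w', hw, hw1, hw2⟩ := cf.char 1 x z v h i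
    set w : ℝ → 𝕜 := fun ξ ↦ matAct (cf.S ξ * Sys.P₁) (v ξ) i with hwdef
    set w₁ : ℝ → ℝ := fun ξ ↦
      RCLike.re ((starRingEnd 𝕜) (((‖w ξ‖⁻¹ : ℝ) : 𝕜) * w ξ) * w' ξ) with hw₁
    -- Multiplied by the sign, the increment of `‖w‖` times the weight from `a` to `b` is exactly
    -- inflow minus `r` times outflow.
    have hprod := (hw.norm Sys.hab.le).mul (cf.hasACDeriv_weight r i)
    have hibp := hprod.eq_integral Sys.hab.le
    rw [← Sys.integral_measure] at hibp
    have hint : Integrable (fun ξ ↦ w₁ ξ * cf.weight r i ξ +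
        ‖w ξ‖ * -(charSign cf.m i * κ)) Sys.measure := by
      have := hprod.int
      rwa [intervalIntegrable_iff_integrableOn_Icc_of_le Sys.hab.le] at this
    have hss : charSign cf.m i * charSign cf.m i = 1 := by
      rcases charSign_eq_or cf.m i with h | h <;> rw [h] <;> norm_num
    have i1 := integrable_weight hρ hρr (T x) i
    have hae : ∀ᵐ ξ ∂Sys.measure, RCLike.re ((starRingEnd 𝕜)
        (((‖T x ξ i‖⁻¹ : ℝ) : 𝕜) * T x ξ i) * T z ξ i) * cf.weight r i ξ ≤
        charSign cf.m i * (w₁ ξ * cf.weight r i ξ + ‖w ξ‖ * -(charSign cf.m i * κ)) +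
        κ * D' * (cf.weight r i ξ * ‖T x ξ i‖) +
        RCLike.re ((starRingEnd 𝕜)
          (((‖T x ξ i‖⁻¹ : ℝ) : 𝕜) * T x ξ i) * R x ξ i) * cf.weight r i ξ := by
      filter_upwards [hT x, hT z, hR x, hw1, hw2, hρr i, ae_restrict_mem measurableSet_Icc] with
        ξ e1 e2 e3 e4 e5 e6 hξ
      have hd := cf.d_pos i ξ hξ
      have hwX : w ξ = ((charSign cf.m i * cf.d i ξ : ℝ) : 𝕜) * T x ξ i := by
        simp only [hwdef]; rw [e4, e1]
      have hnw : ‖w ξ‖ = cf.d i ξ * ‖T x ξ i‖ := by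
        rw [hwX, norm_mul, RCLike.norm_ofReal, abs_mul, abs_of_pos hd]
        rcases charSign_eq_or cf.m i with h | h <;> rw [h] <;> simp
      have hsg : ((‖T x ξ i‖⁻¹ : ℝ) : 𝕜) * T x ξ i =
          ((charSign cf.m i : ℝ) : 𝕜) * (((‖w ξ‖⁻¹ : ℝ) : 𝕜) * w ξ) := by
        rw [hnw, hwX, ← mul_assoc, ← mul_assoc, ← RCLike.ofReal_mul, ← RCLike.ofReal_mul]
        congr 2
        rw [mul_inv]
        calc ‖T x ξ i‖⁻¹ = (charSign cf.m i * charSign cf.m i) *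
              ((cf.d i ξ)⁻¹ * cf.d i ξ) * ‖T x ξ i‖⁻¹ := by
              rw [hss, inv_mul_cancel₀ hd.ne']; ring
          _ = _ := by ring
      have hz : T z ξ i = w' ξ + R x ξ i := by rw [e2, e5, e3]
      rw [hz, mul_add, map_add, add_mul]
      gcongr
      have h1 : RCLike.re ((starRingEnd 𝕜) (((‖T x ξ i‖⁻¹ : ℝ) : 𝕜) * T x ξ i) * w' ξ) =
          charSign cf.m i * w₁ ξ := by
        rw [hsg, map_mul (starRingEnd 𝕜), RCLike.conj_ofReal, mul_assoc, RCLike.re_ofReal_mul]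
      rw [h1, hnw]
      have h2 : cf.d i ξ ≤ D' := by
        calc cf.d i ξ ≤ |D i| := (le_abs_self _).trans ((hD i ξ hξ).trans (le_abs_self _))
          _ ≤ D' := Finset.single_le_sum (f := fun i ↦ |D i|) (fun i _ ↦ abs_nonneg _)
            (Finset.mem_univ i)
      have h3 : cf.d i ξ * ‖T x ξ i‖ ≤ D' * (cf.weight r i ξ * ‖T x ξ i‖) := by
        gcongr
        nlinarith [e6.1, norm_nonneg (T x ξ i)]
      have h4 := mul_le_mul_of_nonneg_left h3 hκ0
      calc charSign cf.m i * w₁ ξ * cf.weight r i ξ ≤ charSign cf.m i * w₁ ξ * cf.weight r i ξ -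
            κ * (cf.d i ξ * ‖T x ξ i‖) + κ * (D' * (cf.weight r i ξ * ‖T x ξ i‖)) := by linarith
        _ = charSign cf.m i * w₁ ξ * cf.weight r i ξ -
            (charSign cf.m i * charSign cf.m i) * κ * (cf.d i ξ * ‖T x ξ i‖) +
            κ * (D' * (cf.weight r i ξ * ‖T x ξ i‖)) := by rw [hss, one_mul]
        _ = _ := by ring
    have j1 : Integrable (fun ξ ↦ charSign cf.m i * (w₁ ξ * cf.weight r i ξ +
        ‖w ξ‖ * -(charSign cf.m i * κ)) + κ * D' * (cf.weight r i ξ * ‖T x ξ i‖)) Sys.measure :=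
      (hint.const_mul _).add (i1.const_mul _)
    refine (integral_mono_ae ((hL3 (T z)).1 i) (j1.add ((hL3 (R x)).1 i)) hae).trans_eq ?_
    simp only [Pi.add_apply]
    rw [integral_add j1 ((hL3 (R x)).1 i), integral_add (hint.const_mul _) (i1.const_mul _),
      integral_const_mul, integral_const_mul, hibp, cf.weight_a, cf.weight_b]
    congr 2
    simp only [incoming, outgoing, mixVec_apply, charSign, hwdef]
    split_ifs <;> ring
  have hsum : L (T z) ≤ (∑ i, ‖cf.incoming v i‖ - r * ∑ i, ‖cf.outgoing v i‖ +
      κ * D' * weightedNorm Sys.measure (cf.weight r) (T x)) + L (R x) := by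
    rw [(hL3 (T z)).2, (hL3 (R x)).2, weightedNorm, Finset.mul_sum, Finset.mul_sum,
      ← Finset.sum_sub_distrib, ← Finset.sum_add_distrib, ← Finset.sum_add_distrib]
    exact Finset.sum_le_sum fun i _ ↦ hterm i
  have hRx : L (R x) ≤ n * r * (‖R‖ * ‖J‖) * weightedNorm Sys.measure (cf.weight r) (T x) := by
    calc L (R x) ≤ weightedNorm Sys.measure (cf.weight r) (R x) := hL1 _
      _ ≤ n * r * ‖R x‖ := weightedNorm_le hρ hρr _
      _ ≤ n * r * (‖R‖ * (‖J‖ * ‖T x‖)) := by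
          gcongr
          refine (R.le_opNorm x).trans ?_
          gcongr
          conv_lhs => rw [← hJT x]
          exact J.le_opNorm _
      _ ≤ n * r * (‖R‖ * (‖J‖ * weightedNorm Sys.measure (cf.weight r) (T x))) := by
          gcongr
          exact norm_le_weightedNorm hρ hρr _
      _ = _ := by ring
  linarith

/-- The input splits as `K` of the incoming plus `Q` of the outgoing values; a left inverse of `K`
solves for the former. -/
theorem exists_incoming_bound (h : Function.Injective fun p ↦ cf.boundary Sys.WB (p, 0)) :
    ∃ c : ℝ, 0 ≤ c ∧ ∀ v : ℝ → KVec 𝕜 n, ∑ i, ‖cf.incoming v i‖ ≤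
      c * (‖bdryAct Sys.WB (v Sys.b) (v Sys.a)‖ + ∑ i, ‖cf.outgoing v i‖) := by
  set K : KVec 𝕜 n →ₗ[𝕜] KVec 𝕜 n := (cf.boundary Sys.WB).comp (LinearMap.inl 𝕜 _ _)
  set Q : KVec 𝕜 n →ₗ[𝕜] KVec 𝕜 n := (cf.boundary Sys.WB).comp (LinearMap.inr 𝕜 _ _)
  obtain ⟨G, hG⟩ := K.exists_leftInverse_of_injective (LinearMap.ker_eq_bot.2 h)
  obtain ⟨c, hc, hb⟩ := LinearMap.exists_kvec_bound
    (G.comp (LinearMap.fst 𝕜 (KVec 𝕜 n) (KVec 𝕜 n) - Q.comp (LinearMap.snd 𝕜 _ _)))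
  refine ⟨c, hc, fun v ↦ ?_⟩
  have h1 := hb (bdryAct Sys.WB (v Sys.b) (v Sys.a)) (cf.outgoing v)
  have h2 : bdryAct Sys.WB (v Sys.b) (v Sys.a) = K (cf.incoming v) + Q (cf.outgoing v) := by
    rw [← cf.boundary_incoming_outgoing]
    change _ = cf.boundary Sys.WB (cf.incoming v, 0) + cf.boundary Sys.WB (0, cf.outgoing v)
    rw [← map_add]; simp
  have h3 : (G.comp (LinearMap.fst 𝕜 (KVec 𝕜 n) (KVec 𝕜 n) - Q.comp (LinearMap.snd 𝕜 _ _)))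
      (bdryAct Sys.WB (v Sys.b) (v Sys.a), cf.outgoing v) = cf.incoming v := by
    change G (bdryAct Sys.WB (v Sys.b) (v Sys.a) - Q (cf.outgoing v)) = _
    rw [h2, add_sub_cancel_right]
    exact congrArg (fun f : KVec 𝕜 n →ₗ[𝕜] KVec 𝕜 n ↦ f (cf.incoming v)) hG
  rwa [h3] at h1

theorem exists_output_bound : ∃ c : ℝ, 0 ≤ c ∧ ∀ v : ℝ → KVec 𝕜 n,
    ‖bdryAct Sys.WC (v Sys.b) (v Sys.a)‖ ≤
      c * (∑ i, ‖cf.incoming v i‖ + ∑ i, ‖cf.outgoing v i‖) := by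
  obtain ⟨c, hc, hb⟩ := LinearMap.exists_kvec_bound (cf.boundary Sys.WC)
  refine ⟨c, hc, fun v ↦ ?_⟩
  rw [← cf.boundary_incoming_outgoing]
  refine (kvec_norm_le_sum _).trans ((hb _ _).trans ?_)
  gcongr
  exact kvec_norm_le_sum _

theorem continuousOn_outgoing {I : Set ℝ} {v : ℝ → ℝ → KVec 𝕜 n}
    (hv : ContinuousOn (fun t ↦ (v t Sys.b, v t Sys.a)) I) (i : Fin n) :
    ContinuousOn (fun t ↦ cf.outgoing (v t) i) I := by
  have h : ∀ M : Matrix (Fin n) (Fin n) 𝕜, Continuous fun q : KVec 𝕜 n ↦ matAct M q i := by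
    intro M; simp only [matAct_apply]; fun_prop
  simp only [outgoing, mixVec_apply]
  split_ifs
  · exact (h _).comp_continuousOn (continuous_snd.comp_continuousOn hv)
  · exact (h _).comp_continuousOn (continuous_fst.comp_continuousOn hv)

end HBCS.CharForm

end Lyapunov

/-! ### The well-posedness estimate -/

section WellPosedness

variable {𝕜 : Type*} [RCLike 𝕜] {n : ℕ}

/-- If the input determines the incoming values, given the outgoing ones, then the system is
well-posed on `L¹`. -/
theorem HBCS.CharForm.wellPosed {Sys : HBCS 𝕜 n} (cf : Sys.CharForm)
    (hSys : Sys.StandingAssumptions)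
    (hinj : Function.Injective fun p ↦ cf.boundary Sys.WB (p, 0)) {t : ℝ} (ht : 0 < t) :
    ∃ c : ℝ, 0 < c ∧
      ∀ (u : ℝ → KVec 𝕜 n) (x : ℝ → Sys.StateSpace 1) (y : ℝ → KVec 𝕜 n),
        Sys.IsClassicalSolution 1 u x y →
          (∫ s in (0 : ℝ)..t, ‖y s‖) + ‖x t‖ ≤ c * ((∫ s in (0 : ℝ)..t, ‖u s‖) + ‖x 0‖) := by
  obtain ⟨T, J, hT, -, hJT⟩ := cf.exists_transform 1
  obtain ⟨c₁, hc₁, hin⟩ := cf.exists_incoming_bound hinj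
  obtain ⟨c₂, hc₂, hy⟩ := cf.exists_output_bound
  -- The excess `1` over `c₁` preserves one copy of the outflow, which later controls the output.
  set r : ℝ := c₁ + 1 with hr
  have hr1 : 1 ≤ r := by linarith
  obtain ⟨C, hC, hdiss⟩ := cf.exists_dissipation hr1 hT hJT
  obtain ⟨G, hG⟩ := Sys.exists_boundary_of_input_output hSys.WBC_fullRank
  have hρ : ∀ i, AEStronglyMeasurable (cf.weight r i) Sys.measure := fun i ↦
    (cf.continuous_weight r i).aestronglyMeasurable
  have hρr := fun i ↦ cf.weight_bounds hr1 i
  set e := Real.exp (C * t) with he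
  have he0 : 0 < e := Real.exp_pos _
  set A : ℝ := e * (n * r * ‖T‖ + c₁) with hA
  have hA0 : 0 ≤ A := by positivity
  -- The terms with `c₂` bound the output, the one with `‖J‖` the state; the final `1` secures
  -- positivity.
  refine ⟨c₂ * c₁ + (c₂ * (c₁ + 1) + ‖J‖) * A + 1, by positivity, fun u x y hsol ↦ ?_⟩
  choose! v hv using hsol.eqn
  -- The traces are continuous in time because input and output are, and together they determine the
  -- traces linearly.
  have hbc : ContinuousOn (fun s ↦ (v s Sys.b, v s Sys.a)) (Ici 0) := by
    refine ((LinearMap.continuous_of_finiteDimensional G).comp_continuousOn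
      (hsol.u_cont.prodMk hsol.y_cont)).congr fun s hs ↦ ?_
    simp only [Function.comp]
    rw [(hv s hs).2.1, (hv s hs).2.2, hG]
  set V : ℝ → ℝ := fun s ↦ weightedNorm Sys.measure (cf.weight r) (T (x s)) with hV
  set o : ℝ → ℝ := fun s ↦ ∑ i, ‖cf.outgoing (v s) i‖ with ho
  have hsub : Icc 0 t ⊆ Ici 0 := Icc_subset_Ici_self
  have hVc : ContinuousOn V (Icc 0 t) :=
    (continuous_weightedNorm hρ hρr (by linarith)).comp_continuousOn
      (T.continuous.comp_continuousOn (hsol.x_contDiff.continuousOn.mono hsub))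
  have hoc : ContinuousOn o (Icc 0 t) := by
    refine continuousOn_finsetSum _ fun i _ ↦ ?_
    exact ((cf.continuousOn_outgoing hbc i).mono hsub).norm
  have huc : ContinuousOn (fun s ↦ ‖u s‖) (Icc 0 t) := (hsol.u_cont.mono hsub).norm
  have hyc : ContinuousOn (fun s ↦ ‖y s‖) (Icc 0 t) := (hsol.y_cont.mono hsub).norm
  have hmain := gronwall_of_left_slope (q := fun s ↦ c₁ * ‖u s‖) ht.le hC hVc hoc
    (continuousOn_const.mul huc) (fun s _ ↦ Finset.sum_nonneg fun i _ ↦ norm_nonneg _)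
    (fun s _ ↦ by positivity) (fun s hs q hq ↦ by
      -- Here `L (T (x z)) ≤ V z` for every `z`, with equality at `z = s`. For `z < s` the quotient
      -- of `V` is therefore at most that of the differentiable function `L ∘ T ∘ x`.
      obtain ⟨L, hL1, hL2, hL3⟩ := hdiss _ _ _ (hv s hs.1.le).1
      have hd : HasDerivAt x (derivWithin x (Ici 0) s) s :=
        ((hsol.x_contDiff.differentiableOn one_ne_zero s hs.1.le).hasDerivWithinAt).hasDerivAt
          (Ici_mem_nhds hs.1)
      have hLd : HasDerivAt (fun s ↦ L (T (x s))) (L (T (derivWithin x (Ici 0) s))) s :=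
        (L.comp (T.restrictScalars ℝ)).hasFDerivAt.comp_hasDerivAt s hd
      have hlt : L (T (derivWithin x (Ici 0) s)) < q := by
        refine (hL3.trans ?_).trans_lt hq
        have h1 := hin (v s)
        rw [← (hv s hs.1.le).2.1] at h1
        simp only [hr, ho, hV]
        linarith
      have h2 := (hasDerivAt_iff_tendsto_slope.1 hLd).mono_left
        (nhdsWithin_mono s fun z (hz : z < s) ↦ hz.ne)
      filter_upwards [h2.eventually_lt_const hlt, self_mem_nhdsWithin] with z hz hzs
      refine lt_of_le_of_lt ?_ hz
      rw [slope_comm, slope_def_field]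
      have := sub_pos.2 (mem_Iio.1 hzs)
      simp only [hV]
      rw [← hL2]
      gcongr
      exact hL1 _)
  rw [intervalIntegral.integral_const_mul] at hmain
  set U : ℝ := ∫ s in (0 : ℝ)..t, ‖u s‖ with hU
  have hU0 : 0 ≤ U := intervalIntegral.integral_nonneg ht.le fun s _ ↦ norm_nonneg _
  have hI : ∀ {f : ℝ → ℝ}, ContinuousOn f (Icc 0 t) → IntervalIntegrable f volume 0 t := fun hf ↦
    ContinuousOn.intervalIntegrable (by rwa [uIcc_of_le ht.le])
  have hV0 : V 0 ≤ n * r * ‖T‖ * ‖x 0‖ := by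
    calc V 0 ≤ n * r * ‖T (x 0)‖ := weightedNorm_le hρ hρr _
      _ ≤ n * r * (‖T‖ * ‖x 0‖) := by gcongr; exact T.le_opNorm _
      _ = _ := by ring
  have hbound : e * (V 0 + c₁ * U) ≤ A * (U + ‖x 0‖) := by
    have h1 : 0 ≤ n * r * ‖T‖ * U := by positivity
    have h2 : 0 ≤ c₁ * ‖x 0‖ := by positivity
    calc e * (V 0 + c₁ * U) ≤ e * ((n * r * ‖T‖ + c₁) * (U + ‖x 0‖)) := by
          gcongr; nlinarith
      _ = _ := by rw [hA]; ring
  have hO0 : 0 ≤ ∫ s in (0 : ℝ)..t, o s :=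
    intervalIntegral.integral_nonneg ht.le fun s _ ↦ Finset.sum_nonneg fun i _ ↦ norm_nonneg _
  have hVt : ‖T (x t)‖ ≤ V t := norm_le_weightedNorm hρ hρr _
  have hxt : ‖x t‖ ≤ ‖J‖ * V t := by
    calc ‖x t‖ = ‖J (T (x t))‖ := by rw [hJT]
      _ ≤ ‖J‖ * ‖T (x t)‖ := J.le_opNorm _
      _ ≤ ‖J‖ * V t := by gcongr
  have hyt : ∫ s in (0 : ℝ)..t, ‖y s‖ ≤ c₂ * c₁ * U + c₂ * (c₁ + 1) * ∫ s in (0 : ℝ)..t, o s := by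
    rw [hU, ← intervalIntegral.integral_const_mul, ← intervalIntegral.integral_const_mul,
      ← intervalIntegral.integral_add ((hI huc).const_mul _) ((hI hoc).const_mul _)]
    refine intervalIntegral.integral_mono_on ht.le (hI hyc)
      (((hI huc).const_mul _).add ((hI hoc).const_mul _)) fun s hs ↦ ?_
    have h1 := hin (v s)
    have h2 := hy (v s)
    rw [← (hv s hs.1).2.1] at h1
    rw [← (hv s hs.1).2.2] at h2
    calc ‖y s‖ ≤ c₂ * (∑ i, ‖cf.incoming (v s) i‖ + o s) := h2
      _ ≤ c₂ * (c₁ * (‖u s‖ + o s) + o s) := by gcongr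
      _ = _ := by ring
  have hVA : V t ≤ A * (U + ‖x 0‖) := by linarith
  have hOA : ∫ s in (0 : ℝ)..t, o s ≤ A * (U + ‖x 0‖) := by
    linarith [norm_nonneg (T (x t))]
  have hx0 := norm_nonneg (x 0)
  calc (∫ s in (0 : ℝ)..t, ‖y s‖) + ‖x t‖ ≤ (c₂ * c₁ * U + c₂ * (c₁ + 1) * (A * (U + ‖x 0‖))) +
        ‖J‖ * (A * (U + ‖x 0‖)) := by
        refine add_le_add (hyt.trans ?_) (hxt.trans ?_) <;> gcongr
    _ ≤ (c₂ * c₁ + (c₂ * (c₁ + 1) + ‖J‖) * A + 1) * (U + ‖x 0‖) := by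
        have h1 : 0 ≤ c₂ * c₁ * ‖x 0‖ := by positivity
        nlinarith

end WellPosedness

end

theorem mainTheorem8 {𝕜 : Type*} [RCLike 𝕜] {n : ℕ} (Sys : HBCS 𝕜 n)
    (hSys : Sys.StandingAssumptions) (hDiag : Sys.DiagonalisationAssumption) :
    ∀ t : ℝ, 0 < t → ∃ c : ℝ, 0 < c ∧
      ∀ (u : ℝ → KVec 𝕜 n) (x : ℝ → Sys.StateSpace 1) (y : ℝ → KVec 𝕜 n),
        Sys.IsClassicalSolution 1 u x y →
          (∫ s in (0 : ℝ)..t, ‖y s‖) + ‖x t‖ ≤ c * ((∫ s in (0 : ℝ)..t, ‖u s‖) + ‖x 0‖) := by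
  obtain ⟨cf⟩ := hDiag.nonempty_charForm hSys
  exact fun t ht ↦ cf.wellPosed hSys (cf.injective_of_generates hSys) ht
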